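/- Let $n\ge 0$. A convex function on $\mathbb R^n$ may take the value $+\infty$ but not $-\infty$. Write $z=x+iy\in\mathbb C^n$ with $x,y\in\mathbb R^n$, and $t\cdot z=\sum_j t_jz_j$. The (diagonal) Bergman kernel of a normed space $H$ of holomorphic functions is $B(z)=\sup_{f\in H,\,f\neq0}|f(z)|^2/\|f\|^2\in[0,\infty]$ (with $\sup\emptyset=0$). (1) Let $\psi$ be a convex function on $\mathbb R^n$ and let $U\subseteq\mathbb R^n$ be any open set. Let $PW(e^{\psi})$ be the space of holomorphic functions $f$ on the tube $U+i\mathbb R^n$ of the form $f(z)=\int_{\mathbb R^n}e^{t\cdot z}\tilde f(t)\,dt$, where $\tilde f$ is measurable, the integral converges absolutely for every $z\in U+i\mathbb R^n$, and $\|f\|_{PW}^2:=\int_{\mathbb R^n}|\tilde f|^2e^{\psi}\,dt<\infty$ (so $\tilde f=0$ almost everywhere on $\{\psi=\infty\}$). Then the Bergman kernel of $PW(e^{\psi})$ is $$B(z)=\int_{\mathbb R^n}e^{2t\cdot x-\psi(t)}\,dt\in[0,\infty]\qquad\text{for all } z=x+iy\in U+i\mathbb R^n .$$ In particular ($U=\mathbb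 R^n$) the formula holds at every $z\in\mathbb C^n$ for the space of entire functions of this form. (2) Let $\varphi$ be a convex function on $\mathbb R^n$, let $\Omega$ be the interior of $\{\varphi<\infty\}$, and let $A^2(e^{-\varphi})$ be the space of holomorphic functions $f$ on $\Omega+i\mathbb R^n$ with $\|f\|_{A^2}^2:=\int_{\Omega+i\mathbb R^n}|f(x+iy)|^2e^{-\varphi(x)}\,dx\,dy<\infty$. Let $\tilde\varphi$ be the logarithmic Laplace transform of $\varphi$, defined by $e^{\tilde\varphi(t)}=\int_{\mathbb R^n}e^{2t\cdot x-\varphi(x)}\,dx$. Then the Bergman kernel of $A^2(e^{-\varphi})$ is $$B(z)=(2\pi)^{-n}\int_{\mathbb R^n}e^{2t\cdot x-\tilde\varphi(t)}\,dt\qquad\text{for all } z=x+iy\in\Omega+i\mathbb R^n .$$ -/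

import Mathlib

open MeasureTheory
open scoped ENNReal

namespace PaleyWiener

/-- A convex function `ℝⁿ → (-∞, +∞]`: it never takes the value `-∞`, and its epigraph is convex. -/
structure IsConvexFun {n : ℕ} (ψ : (Fin n → ℝ) → EReal) : Prop where
  ne_bot : ∀ t, ψ t ≠ ⊥
  convex_epigraph : Convex ℝ {p : (Fin n → ℝ) × ℝ | ψ p.1 ≤ (p.2 : EReal)}

/-- The real part `x` of `z = x + iy` in `ℂⁿ`. -/
def rePart {n : ℕ} (z : Fin n → ℂ) : Fin n → ℝ := fun i => (z i).re

/-- The bilinear product `t · x` for `t, x` in `ℝⁿ`. -/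
def dotR {n : ℕ} (t x : Fin n → ℝ) : ℝ := ∑ i, t i * x i

/-- The bilinear product `t · z` for `t` in `ℝⁿ` and `z` in `ℂⁿ`. -/
def dotC {n : ℕ} (t : Fin n → ℝ) (z : Fin n → ℂ) : ℂ := ∑ i, (t i : ℂ) * z i

/-- The tube `U + iℝⁿ` over a set `U` in `ℝⁿ`. -/
def tube {n : ℕ} (U : Set (Fin n → ℝ)) : Set (Fin n → ℂ) := {z | rePart z ∈ U}

/-- The diagonal Bergman kernel `sup |f(z)|² / ‖f‖²` of a space `S` of functions with squared norm
`normSq`, as an element of `[0, ∞]`. The zero function contributes `0 / 0 = 0`. -/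
noncomputable def bergmanKernel {n : ℕ} (S : Set ((Fin n → ℂ) → ℂ))
    (normSq : ((Fin n → ℂ) → ℂ) → ℝ≥0∞) (z : Fin n → ℂ) : ℝ≥0∞ :=
  ⨆ f ∈ S, ‖f z‖ₑ ^ 2 / normSq f

/-- `∫ |g|² e^ψ dt`. As `0 * ∞ = 0` and `e^∞ = ∞`, finiteness forces `g = 0` almost everywhere on
the set where `ψ = ∞`. -/
noncomputable def weightedNormSq {n : ℕ} (ψ : (Fin n → ℝ) → EReal) (g : (Fin n → ℝ) → ℂ) : ℝ≥0∞ :=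
  ∫⁻ t, ‖g t‖ₑ ^ 2 * EReal.exp (ψ t)

/-- `g` has finite weighted norm and `f(z) = ∫ e^{t·z} g(t) dt`, with an absolutely convergent
integral, for all `z` in the tube over `U`. -/
structure Represents {n : ℕ} (ψ : (Fin n → ℝ) → EReal) (U : Set (Fin n → ℝ))
    (f : (Fin n → ℂ) → ℂ) (g : (Fin n → ℝ) → ℂ) : Prop where
  aestronglyMeasurable : AEStronglyMeasurable g volume
  weightedNormSq_lt_top : weightedNormSq ψ g < ∞
  integrable : ∀ z ∈ tube U, Integrable (fun t => Complex.exp (dotC t z) * g t) volume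
  eq_integral : ∀ z ∈ tube U, f z = ∫ t, Complex.exp (dotC t z) * g t

/-- The generalized Paley-Wiener space `PW(e^ψ)`, realized as a space of holomorphic functions on
the tube over `U`. -/
def PW {n : ℕ} (ψ : (Fin n → ℝ) → EReal) (U : Set (Fin n → ℝ)) : Set ((Fin n → ℂ) → ℂ) :=
  {f | DifferentiableOn ℂ f (tube U) ∧ ∃ g, Represents ψ U f g}

/-- The squared norm `∫ |g|² e^ψ dt` of `f = ∫ e^{t·z} g(t) dt` in `PW(e^ψ)`. For nonempty `U` the
function `g` is determined by `f` up to a null set, by uniqueness of the Fourier transform, so the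
infimum is over copies of one number. -/
noncomputable def pwNormSq {n : ℕ} (ψ : (Fin n → ℝ) → EReal) (U : Set (Fin n → ℝ))
    (f : (Fin n → ℂ) → ℂ) : ℝ≥0∞ :=
  ⨅ (g : (Fin n → ℝ) → ℂ) (_ : Represents ψ U f g), weightedNormSq ψ g

/-- The interior of the set where `φ` is finite. -/
def finiteInterior {n : ℕ} (φ : (Fin n → ℝ) → EReal) : Set (Fin n → ℝ) :=
  interior {x | φ x < ⊤}

/-- `∫ |f(x+iy)|² e^{-φ(x)} dx dy` over the tube where `φ` is finite. (For convex `φ` the boundary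
of that tube is a null set.) -/
noncomputable def bergmanNormSq {n : ℕ} (φ : (Fin n → ℝ) → EReal) (f : (Fin n → ℂ) → ℂ) : ℝ≥0∞ :=
  ∫⁻ z in tube (finiteInterior φ), ‖f z‖ₑ ^ 2 * EReal.exp (-φ (rePart z))

/-- The Bergman space `A²(e^{-φ})`. -/
def bergmanSpace {n : ℕ} (φ : (Fin n → ℝ) → EReal) : Set ((Fin n → ℂ) → ℂ) :=
  {f | DifferentiableOn ℂ f (tube (finiteInterior φ)) ∧ bergmanNormSq φ f < ∞}

/-- The logarithmic Laplace transform `log ∫ e^{2t·x - φ(x)} dx`. -/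
noncomputable def logLaplace {n : ℕ} (φ : (Fin n → ℝ) → EReal) (t : Fin n → ℝ) : EReal :=
  ENNReal.log (∫⁻ x, EReal.exp (((2 * dotR t x : ℝ) : EReal) - φ x))

end PaleyWiener

namespace PaleyWiener

variable {n : ℕ}


/-! For `f(z) = ∫ e^{t·z} g(t) dt` with squared norm `∫ |g|² a dt`, Cauchy-Schwarz gives `|f(z)|² ≤
∫ |g|² a · ∫ e^{2t·x} / a` (`enorm_integral_sq_le`), with equality for `g = conj(e^{t·z}) / a`. This
`g` may fail to have finite norm, so it is truncated to bounded `t` and bounded `1/a`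
(`exists_extremal`). The truncations have entire Laplace transforms, and their ratios increase to
the integral even when it is infinite. With `a = e^ψ` this is (1).

For (2), Plancherel on each slice `x + iℝⁿ` and Tonelli turn the Bergman norm of such an `f` into
`(2π)^n ∫ |g|² a`, where `a` is the Laplace transform of the weight (`lintegral_tube_laplace`).
Truncated extremals then give the lower bound. The upper bound needs a Laplace representation of an
arbitrary `f` in the space, but `f` need not be integrable on slices. It is bounded on tubes over
compact sets by the sub-mean value property, so multiplying it by `e^{ε ∑ (wᵢ - zᵢ)²}`, which is `1`
at `w = z`, produces Gaussian decay in `y`. Shifting the contour (`integral_toC_eq`) and Fourier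
inversion then represent the product (`exists_eq_laplace`). The multiplier is controlled only over
bounded `x`, so Cauchy-Schwarz is applied with the weight integrated over a compact `K`
(`enorm_sq_le_of_isCompact`). Finally `ε → 0`, and `K` exhausts the domain by dominated convergence.
-/

lemma exp_coe_sub (c : ℝ) (w : EReal) :
    EReal.exp ((c : EReal) - w) = ENNReal.ofReal (Real.exp c) * (EReal.exp w)⁻¹ := by
  rw [sub_eq_add_neg, EReal.exp_add, EReal.exp_neg, EReal.exp_coe]

lemma re_dotC (t : Fin n → ℝ) (z : Fin n → ℂ) : (dotC t z).re = dotR t (rePart z) := by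
  simp [dotC, dotR, rePart]

lemma enorm_exp_dotC_sq (t : Fin n → ℝ) (z : Fin n → ℂ) :
    ‖Complex.exp (dotC t z)‖ₑ ^ 2 = ENNReal.ofReal (Real.exp (2 * dotR t (rePart z))) := by
  rw [← ofReal_norm, ← ENNReal.ofReal_pow (norm_nonneg _), Complex.norm_exp, re_dotC,
    two_mul, Real.exp_add, sq]

@[fun_prop]
lemma continuous_dotR {X : Type*} [TopologicalSpace X] {f g : X → Fin n → ℝ}
    (hf : Continuous f) (hg : Continuous g) : Continuous fun p => dotR (f p) (g p) := by
  unfold dotR; fun_prop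

@[fun_prop]
lemma continuous_dotC {X : Type*} [TopologicalSpace X] {f : X → Fin n → ℝ} {g : X → Fin n → ℂ}
    (hf : Continuous f) (hg : Continuous g) : Continuous fun p => dotC (f p) (g p) := by
  unfold dotC; fun_prop

@[fun_prop]
lemma continuous_rePart {X : Type*} [TopologicalSpace X] {g : X → Fin n → ℂ}
    (hg : Continuous g) : Continuous fun p => rePart (g p) := by
  unfold rePart; fun_prop

/-! ### Measurability of convex functions and weighted Cauchy-Schwarz. -/

lemma IsConvexFun.convex_lt {ψ : (Fin n → ℝ) → EReal} (h : IsConvexFun ψ) (c : EReal) :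
    Convex ℝ {x | ψ x < c} := by
  intro x hx y hy a b ha hb hab
  obtain ⟨r, hxr, hr⟩ := EReal.lt_iff_exists_real_btwn.1 hx
  obtain ⟨s, hys, hs⟩ := EReal.lt_iff_exists_real_btwn.1 hy
  have hc := h.convex_epigraph (x := (x, r)) (y := (y, s)) hxr.le hys.le ha hb hab
  have hc' : ψ (a • x + b • y) ≤ ((a * r + b * s : ℝ) : EReal) := hc
  refine lt_of_le_of_lt hc' (lt_of_le_of_lt ?_ (max_lt hr hs))
  rw [← EReal.coe_strictMono.monotone.map_max, EReal.coe_le_coe_iff]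
  calc a * r + b * s ≤ a * max r s + b * max r s := by
        gcongr
        · exact le_max_left _ _
        · exact le_max_right _ _
    _ = max r s := by rw [← add_mul, hab, one_mul]

/-- Strict sublevel sets are convex, hence null measurable, and the rays `Iio c` generate the Borel
sets. Borel measurability can fail, because values on the boundary of the domain are nearly
arbitrary. -/
lemma IsConvexFun.aemeasurable {ψ : (Fin n → ℝ) → EReal} (h : IsConvexFun ψ) :
    AEMeasurable ψ volume := by
  have : NullMeasurable ψ volume := by
    have := borel_eq_generateFrom_Iio EReal
    rw [← BorelSpace.measurable_eq (α := EReal)] at this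
    intro s hs
    rw [this] at hs
    induction s, hs using MeasurableSpace.generateFrom_induction with
    | hC s hs _ =>
      obtain ⟨c, rfl⟩ := hs
      exact (h.convex_lt c).nullMeasurableSet volume
    | empty => simp
    | compl s _ hs => exact hs.compl
    | iUnion f _ hf => rw [Set.preimage_iUnion]; exact NullMeasurableSet.iUnion hf
  exact this.aemeasurable

/-- The Cauchy-Schwarz inequality for the weights `a` and `a⁻¹`. -/
lemma enorm_integral_sq_le {a : (Fin n → ℝ) → ℝ≥0∞} (ha : AEMeasurable a volume)
    (ha0 : ∀ᵐ t, a t ≠ 0) {g : (Fin n → ℝ) → ℂ} (hg : AEStronglyMeasurable g volume)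
    (hfin : ∫⁻ t, ‖g t‖ₑ ^ 2 * a t < ∞) (z : Fin n → ℂ) :
    ‖∫ t, Complex.exp (dotC t z) * g t‖ₑ ^ 2 ≤ (∫⁻ t, ‖g t‖ₑ ^ 2 * a t) *
      ∫⁻ t, ENNReal.ofReal (Real.exp (2 * dotR t (rePart z))) * (a t)⁻¹ := by
  have hsq : ∀ x : ℝ≥0∞, (x ^ (1 / 2 : ℝ)) ^ 2 = x := fun x => by
    rw [← ENNReal.rpow_natCast, ← ENNReal.rpow_mul]; norm_num
  have hgm : AEMeasurable (fun t => ‖g t‖ₑ ^ 2 * a t) := (hg.enorm.pow_const 2).mul ha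
  have h1 : ∀ᵐ t, ‖Complex.exp (dotC t z) * g t‖ₑ ≤
      (‖g t‖ₑ * (a t) ^ (1 / 2 : ℝ)) * (‖Complex.exp (dotC t z)‖ₑ * ((a t)⁻¹) ^ (1 / 2 : ℝ)) := by
    filter_upwards [ae_lt_top' hgm hfin.ne, ha0] with t ht ht0
    -- Where `a = ∞`, finiteness of the norm forces `g = 0`; elsewhere `a^{1/2} (a⁻¹)^{1/2} = 1` can
    -- be inserted.
    by_cases hat : a t = ∞
    · have : ‖g t‖ₑ = 0 := by
        by_contra h
        rw [hat, ENNReal.mul_top (pow_ne_zero 2 h)] at ht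
        exact lt_irrefl _ ht
      rw [enorm_mul, this]; simp
    · have : (a t) ^ (1 / 2 : ℝ) * ((a t)⁻¹) ^ (1 / 2 : ℝ) = 1 := by
        rw [← ENNReal.mul_rpow_of_nonneg _ _ (by norm_num), ENNReal.mul_inv_cancel ht0 hat,
          ENNReal.one_rpow]
      rw [enorm_mul, mul_mul_mul_comm, this, mul_one, mul_comm]
  calc ‖∫ t, Complex.exp (dotC t z) * g t‖ₑ ^ 2
      ≤ (∫⁻ t, (‖g t‖ₑ * (a t) ^ (1 / 2 : ℝ)) *
          (‖Complex.exp (dotC t z)‖ₑ * ((a t)⁻¹) ^ (1 / 2 : ℝ))) ^ 2 := by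
        gcongr
        exact (enorm_integral_le_lintegral_enorm _).trans (lintegral_mono_ae h1)
    _ ≤ ((∫⁻ t, (‖g t‖ₑ * (a t) ^ (1 / 2 : ℝ)) ^ (2 : ℝ)) ^ (1 / 2 : ℝ) *
        (∫⁻ t, (‖Complex.exp (dotC t z)‖ₑ * ((a t)⁻¹) ^ (1 / 2 : ℝ)) ^ (2 : ℝ)) ^ (1 / 2 : ℝ)) ^ 2
          := by
        gcongr
        refine ENNReal.lintegral_mul_le_Lp_mul_Lq volume Real.HolderConjugate.two_two ?_ ?_
        · exact hg.enorm.mul (ha.pow_const _)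
        · exact (Continuous.aemeasurable (by fun_prop)).enorm.mul (ha.inv.pow_const _)
    _ = _ := by
        rw [mul_pow, hsq, hsq]
        simp only [ENNReal.rpow_ofNat, mul_pow, hsq, enorm_exp_dotC_sq]


/-! ### Entire Laplace transforms and truncated extremals. -/

/-- A bounded measurable function with bounded support. -/
structure IsBddSupp (g : (Fin n → ℝ) → ℂ) : Prop where
  measurable : Measurable g
  exists_bound : ∃ C R : ℝ, ∀ t, ‖g t‖ ≤ C ∧ (R < ‖t‖ → g t = 0)

lemma IsBddSupp.mul_continuous {g : (Fin n → ℝ) → ℂ} (hg : IsBddSupp g)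
    {k : (Fin n → ℝ) → ℂ} (hk : Continuous k) : IsBddSupp fun t => k t * g t := by
  refine ⟨hk.measurable.mul hg.measurable, ?_⟩
  obtain ⟨C, R, h⟩ := hg.exists_bound
  obtain ⟨D, hD⟩ := (isCompact_closedBall (0 : Fin n → ℝ) R).exists_bound_of_continuousOn
    hk.continuousOn
  have hC : 0 ≤ C := (norm_nonneg _).trans (h 0).1
  refine ⟨|D| * C, R, fun t => ⟨?_, fun ht => by rw [(h t).2 ht, mul_zero]⟩⟩
  rcases le_or_gt ‖t‖ R with ht | ht
  · rw [norm_mul]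
    exact mul_le_mul ((hD t (by simpa using ht)).trans (le_abs_self D)) (h t).1 (norm_nonneg _)
      (abs_nonneg _)
  · rw [(h t).2 ht, mul_zero, norm_zero]; positivity

lemma IsBddSupp.integrable {g : (Fin n → ℝ) → ℂ} (hg : IsBddSupp g) : Integrable g := by
  obtain ⟨C, R, h⟩ := hg.exists_bound
  have : IntegrableOn g (Metric.closedBall 0 R) :=
    Measure.integrableOn_of_bounded measure_closedBall_lt_top.ne
      hg.measurable.aestronglyMeasurable (.of_forall fun t => (h t).1)
  rwa [integrableOn_iff_integrable_of_support_subset] at this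
  intro t ht
  by_contra hR
  exact ht ((h t).2 (by simpa using hR))

lemma IsBddSupp.memLp_two {g : (Fin n → ℝ) → ℂ} (hg : IsBddSupp g) : MemLp g 2 := by
  obtain ⟨C, R, h⟩ := hg.exists_bound
  refine (memLp_two_iff_integrable_sq_norm hg.measurable.aestronglyMeasurable).2 ?_
  have := hg.integrable.norm.bdd_mul (c := C) hg.integrable.norm.1
    (.of_forall fun t => by simpa using (h t).1)
  simpa only [← sq] using this

/-- The functional `z ↦ t · z`. -/
noncomputable def dotL (t : Fin n → ℝ) : (Fin n → ℂ) →L[ℂ] ℂ :=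
  ∑ i, (t i : ℂ) • ContinuousLinearMap.proj (R := ℂ) (φ := fun _ : Fin n => ℂ) i

lemma dotL_apply (t : Fin n → ℝ) (z : Fin n → ℂ) : dotL t z = dotC t z := by
  simp [dotL, dotC]

lemma continuous_dotL : Continuous (dotL (n := n)) := by
  unfold dotL; fun_prop

lemma hasFDerivAt_exp_dotC (t : Fin n → ℝ) (z : Fin n → ℂ) :
    HasFDerivAt (fun z => Complex.exp (dotC t z)) (Complex.exp (dotC t z) • dotL t) z := by
  have := (dotL t).hasFDerivAt (x := z)
  simpa only [dotL_apply] using this.cexp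

/-- The Laplace transform of a bounded function with bounded support is entire. -/
lemma IsBddSupp.differentiable_laplace {g : (Fin n → ℝ) → ℂ} (hg : IsBddSupp g) :
    Differentiable ℂ fun z => ∫ t, Complex.exp (dotC t z) * g t := by
  intro z₀
  obtain ⟨C, R, h⟩ := hg.exists_bound
  have hC : 0 ≤ C := (norm_nonneg _).trans (h 0).1
  have hint : ∀ z, Integrable fun t => Complex.exp (dotC t z) * g t := fun z =>
    (hg.mul_continuous (k := fun t => Complex.exp (dotC t z)) (by fun_prop)).integrable
  have hcont : Continuous fun p : (Fin n → ℝ) × (Fin n → ℂ) =>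
      Complex.exp (dotC p.1 p.2) • dotL p.1 :=
    (Continuous.cexp (by fun_prop)).smul (continuous_dotL.comp continuous_fst)
  obtain ⟨D, hD⟩ := ((isCompact_closedBall (0 : Fin n → ℝ) R).prod
    (isCompact_closedBall z₀ 1)).exists_bound_of_continuousOn hcont.continuousOn
  refine (hasFDerivAt_integral_of_dominated_of_fderiv_le
    (F' := fun z t => g t • (Complex.exp (dotC t z) • dotL t))
    (bound := (Metric.closedBall 0 R).indicator fun _ => C * |D|)
    (Metric.closedBall_mem_nhds z₀ one_pos) (.of_forall fun z => (hint z).1) (hint z₀) ?_ ?_ ?_ ?_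
    ).differentiableAt
  · exact hg.measurable.aestronglyMeasurable.smul
      (hcont.comp (by fun_prop : Continuous fun t => (t, z₀))).aestronglyMeasurable
  · refine .of_forall fun t z hz => ?_
    rcases le_or_gt ‖t‖ R with ht | ht
    · rw [Set.indicator_of_mem (by simpa using ht), norm_smul]
      exact mul_le_mul (h t).1 ((hD (t, z) ⟨by simpa using ht, hz⟩).trans (le_abs_self D))
        (norm_nonneg _) hC
    · rw [(h t).2 ht, norm_smul, norm_zero, zero_mul]
      exact Set.indicator_nonneg (fun _ _ => by positivity) _
  · rw [integrable_indicator_iff measurableSet_closedBall]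
    exact integrableOn_const measure_closedBall_lt_top.ne
  · refine .of_forall fun t z _ => ?_
    simpa [mul_comm] using (hasFDerivAt_exp_dotC t z).mul_const (g t)

/-- Truncations of the extremal function in the Cauchy-Schwarz inequality. -/
lemma exists_extremal {a : (Fin n → ℝ) → ℝ≥0∞} (ha : AEMeasurable a volume)
    (ha0 : ∀ᵐ t, a t ≠ 0) (z : Fin n → ℂ) {c : ℝ≥0∞}
    (hc : c < ∫⁻ t, ENNReal.ofReal (Real.exp (2 * dotR t (rePart z))) * (a t)⁻¹) :
    ∃ g : (Fin n → ℝ) → ℂ, IsBddSupp g ∧ ∃ J : ℝ≥0∞, c < J ∧ J < ∞ ∧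
      ‖∫ t, Complex.exp (dotC t z) * g t‖ₑ = J ∧ ∫⁻ t, ‖g t‖ₑ ^ 2 * a t = J := by
  -- `b` is a genuinely measurable version of `a⁻¹`, so the truncation sets below are measurable.
  obtain ⟨b, hb, hab⟩ := ha.inv
  have hab' : ∀ᵐ t, (a t)⁻¹ = b t := hab
  set E : (Fin n → ℝ) → ℝ≥0∞ := fun t => ENNReal.ofReal (Real.exp (2 * dotR t (rePart z)))
    with hE
  have hEm : Measurable E := by
    refine ENNReal.measurable_ofReal.comp (Continuous.measurable ?_)
    fun_prop
  set S : ℕ → Set (Fin n → ℝ) := fun m => {t | ‖t‖ ≤ m ∧ b t ≤ m} with hS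
  have hSm : ∀ m, MeasurableSet (S m) := fun m =>
    (measurableSet_le measurable_norm measurable_const).inter
      (measurableSet_le hb measurable_const)
  have hI : ∫⁻ t, E t * (a t)⁻¹ = ⨆ m, ∫⁻ t, (S m).indicator (fun t => E t * b t) t := by
    have hm : ∀ m, Measurable ((S m).indicator fun t => E t * b t) :=
      fun m => (hEm.mul hb).indicator (hSm m)
    rw [← lintegral_iSup hm]
    · refine lintegral_congr_ae ?_
      filter_upwards [hab', ha0] with t ht ht0
      have hbt : b t ≠ ∞ := by rw [← ht]; simpa using ht0
      rw [ht]
      refine le_antisymm ?_ (iSup_le fun m => Set.indicator_le_self _ _ _)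
      obtain ⟨m₁, hm₁⟩ := exists_nat_ge ‖t‖
      obtain ⟨m₂, hm₂⟩ := ENNReal.exists_nat_gt hbt
      refine le_iSup_of_le (max m₁ m₂) ?_
      rw [Set.indicator_of_mem]
      refine ⟨hm₁.trans (by exact_mod_cast le_max_left _ _), hm₂.le.trans ?_⟩
      exact_mod_cast le_max_right _ _
    · intro m₁ m₂ hm t
      refine Set.indicator_le_indicator_of_subset (fun t ht => ?_) (fun _ => zero_le) _
      exact ⟨ht.1.trans (by exact_mod_cast hm), ht.2.trans (by exact_mod_cast hm)⟩
  rw [hI, lt_iSup_iff] at hc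
  obtain ⟨m, hm⟩ := hc
  -- The equality case of Cauchy-Schwarz, cut off to `S m`: both `e^{t·z} g` and `|g|² a` equal
  -- `e^{2t·x} / a` there almost everywhere, so the value at `z` and the squared norm are the same
  -- number `J`.
  set g : (Fin n → ℝ) → ℂ := fun t =>
    (starRingEnd ℂ) (Complex.exp (dotC t z)) * (S m).indicator (fun t => ((b t).toReal : ℂ)) t
    with hg
  have hbdd : IsBddSupp g := by
    refine IsBddSupp.mul_continuous ⟨?_, m, m, fun t => ⟨?_, fun ht => ?_⟩⟩ (by fun_prop)
    · exact Measurable.indicator (by fun_prop) (hSm m)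
    · by_cases ht : t ∈ S m
      · rw [Set.indicator_of_mem ht, Complex.norm_real, Real.norm_of_nonneg ENNReal.toReal_nonneg]
        exact ENNReal.toReal_le_of_le_ofReal (by positivity) (by simpa using ht.2)
      · rw [Set.indicator_of_notMem ht, norm_zero]; positivity
    · exact Set.indicator_of_notMem (fun h => absurd h.1 (not_le.2 ht)) _
  have hint := (hbdd.mul_continuous (k := fun t => Complex.exp (dotC t z)) (by fun_prop)).integrable
  have hpt : ∀ t, Complex.exp (dotC t z) * g t =
      (((S m).indicator (fun t => E t * b t) t).toReal : ℂ) := by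
    intro t
    by_cases ht : t ∈ S m
    · simp only [hg, Set.indicator_of_mem ht, hE, ENNReal.toReal_mul]
      rw [← mul_assoc, Complex.mul_conj, ENNReal.toReal_ofReal (Real.exp_nonneg _),
        Complex.normSq_eq_norm_sq, Complex.norm_exp, re_dotC, two_mul, Real.exp_add, sq]
      push_cast; ring
    · simp [hg, Set.indicator_of_notMem ht]
  have hfin : ∀ t, (S m).indicator (fun t => E t * b t) t ≠ ∞ := by
    intro t
    by_cases ht : t ∈ S m
    · rw [Set.indicator_of_mem ht]
      exact ENNReal.mul_ne_top ENNReal.ofReal_ne_top (ne_top_of_le_ne_top (by simp) ht.2)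
    · simp [Set.indicator_of_notMem ht]
  have hJ : ENNReal.ofReal (∫ t, ((S m).indicator (fun t => E t * b t) t).toReal) =
      ∫⁻ t, (S m).indicator (fun t => E t * b t) t := by
    rw [ofReal_integral_eq_lintegral_ofReal]
    · simp only [ENNReal.ofReal_toReal (hfin _)]
    · simp only [hpt] at hint
      exact hint.re
    · exact .of_forall fun t => ENNReal.toReal_nonneg
  refine ⟨g, hbdd, _, hm, ?_, ?_, ?_⟩
  · rw [← hJ]; exact ENNReal.ofReal_lt_top
  · simp only [hpt]
    rw [integral_complex_ofReal, ← hJ, ← ofReal_norm, Complex.norm_real, Real.norm_of_nonneg]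
    exact integral_nonneg fun t => ENNReal.toReal_nonneg
  · refine lintegral_congr_ae ?_
    filter_upwards [hab', ha0] with t ht ht0
    by_cases htS : t ∈ S m
    · simp only [hg, Set.indicator_of_mem htS, enorm_mul, mul_pow, RCLike.enorm_conj,
        enorm_exp_dotC_sq]
      rw [← ofReal_norm (((b t).toReal : ℂ)), Complex.norm_real,
        Real.norm_of_nonneg ENNReal.toReal_nonneg,
        ENNReal.ofReal_toReal (ne_top_of_le_ne_top (by simp) htS.2), mul_assoc, sq, ← ht]
      rcases eq_or_ne (a t) ∞ with h | h
      · simp [h]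
      · rw [mul_assoc, ENNReal.inv_mul_cancel ht0 h, mul_one]
    · simp [hg, Set.indicator_of_notMem htS]

/-- The Bergman kernel of a generalized Paley-Wiener space. -/
theorem bergmanKernel_PW {ψ : (Fin n → ℝ) → EReal} (hψ : IsConvexFun ψ) {U : Set (Fin n → ℝ)}
    {z : Fin n → ℂ} (hz : rePart z ∈ U) :
    bergmanKernel (PW ψ U) (pwNormSq ψ U) z =
      ∫⁻ t, EReal.exp (((2 * dotR t (rePart z) : ℝ) : EReal) - ψ t) := by
  have ha : AEMeasurable (fun t => EReal.exp (ψ t)) :=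
    EReal.measurable_exp.comp_aemeasurable hψ.aemeasurable
  have ha0 : ∀ᵐ t, EReal.exp (ψ t) ≠ 0 := .of_forall fun t => by simpa using hψ.ne_bot t
  simp only [exp_coe_sub]
  set I := ∫⁻ t, ENNReal.ofReal (Real.exp (2 * dotR t (rePart z))) * (EReal.exp (ψ t))⁻¹ with hI
  refine le_antisymm (iSup₂_le fun f hf => ?_) (le_of_forall_lt fun c hc => ?_)
  · obtain ⟨-, g₀, hg₀⟩ := hf
    rcases eq_or_ne I ∞ with htop | htop
    · rw [htop]; exact le_top
    have hle : ∀ g, Represents ψ U f g → ‖f z‖ₑ ^ 2 ≤ weightedNormSq ψ g * I := fun g hg => by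
      rw [hg.eq_integral z hz]
      exact enorm_integral_sq_le ha ha0 hg.aestronglyMeasurable hg.weightedNormSq_lt_top z
    refine ENNReal.div_le_of_le_mul' ?_
    -- Dividing by `I` isolates the infimum over representing `g`, which needs `I ≠ 0`; if `I = 0`,
    -- one representative already forces `f z = 0`.
    rcases eq_or_ne I 0 with h0 | h0
    · simpa [h0] using hle g₀ hg₀
    · rw [← ENNReal.div_le_iff h0 htop]
      exact le_iInf₂ fun g hg => ENNReal.div_le_of_le_mul (hle g hg)
  · obtain ⟨g, hg, J, hcJ, hJ, h1, h2⟩ := exists_extremal ha ha0 z hc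
    have hrep : Represents ψ U (fun z => ∫ t, Complex.exp (dotC t z) * g t) g :=
      ⟨hg.measurable.aestronglyMeasurable, h2.trans_lt hJ, fun z _ =>
        (hg.mul_continuous (k := fun t => Complex.exp (dotC t z)) (by fun_prop)).integrable,
        fun _ _ => rfl⟩
    refine hcJ.trans_le (le_trans ?_ (le_iSup₂_of_le _
      ⟨hg.differentiable_laplace.differentiableOn, g, hrep⟩ le_rfl))
    rw [h1]
    calc J = J ^ 2 / J := by
          rw [sq, ENNReal.mul_div_cancel_right (pos_of_gt hcJ).ne' hJ.ne]
      _ ≤ _ := ENNReal.div_le_div_left ((iInf₂_le g hrep).trans h2.le) _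


/-! ### Plancherel and Fourier inversion. -/

section Fourier

open FourierTransform SchwartzMap
open scoped ContDiff

variable {V : Type*} [NormedAddCommGroup V] [InnerProductSpace ℝ V] [FiniteDimensional ℝ V]
  [MeasurableSpace V] [BorelSpace V]

lemma continuous_fourier_of_integrable {f : V → ℂ} (hf : Integrable f) : Continuous (𝓕 f) :=
  VectorFourier.fourierIntegral_continuous Real.continuous_fourierChar
    (L := innerₗ V) continuous_inner hf

/-- The Fourier integral agrees with the Fourier transform on `L²`. -/
lemma fourier_toLp_ae_eq {f : V → ℂ} (h1 : Integrable f) (h2 : MemLp f 2) :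
    (𝓕 (h2.toLp f) : Lp ℂ 2 (volume : Measure V)) =ᵐ[volume] 𝓕 f := by
  -- Both sides are tested against smooth compactly supported functions: the `L²` transform agrees
  -- with the distributional one, and the Fourier integral can be moved across the pairing.
  refine ae_eq_of_integral_contDiff_smul_eq ?_ ?_ fun g hg hgs => ?_
  · exact (Lp.memLp _).locallyIntegrable (by norm_num)
  · exact (continuous_fourier_of_integrable h1).locallyIntegrable
  · have hg₁ : HasCompactSupport (Complex.ofRealCLM ∘ g) := hgs.comp_left rfl
    have hg₂ : ContDiff ℝ ∞ (Complex.ofRealCLM ∘ g) := by fun_prop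
    set s : 𝓢(V, ℂ) := hg₁.toSchwartzMap hg₂
    have hs : ∀ x, s x = (g x : ℂ) := fun x => by simp [s]
    have key := congrArg (fun T => T s) (Lp.fourier_toTemperedDistribution_eq (h2.toLp f))
    simp only [TemperedDistribution.fourier_apply, Lp.toTemperedDistribution_apply] at key
    calc ∫ x, g x • (𝓕 (h2.toLp f) : Lp ℂ 2 (volume : Measure V)) x
        = ∫ x, s x • (𝓕 (h2.toLp f) : Lp ℂ 2 (volume : Measure V)) x := by
          simp only [hs, Complex.coe_smul]
      _ = ∫ x, (𝓕 s) x • (h2.toLp f) x := key.symm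
      _ = ∫ x, (𝓕 (s : V → ℂ)) x • f x := by
          refine integral_congr_ae ?_
          filter_upwards [h2.coeFn_toLp] with x hx
          rw [hx, SchwartzMap.fourier_coe]
      _ = ∫ x, s x • 𝓕 f x := by
          simpa using! VectorFourier.integral_fourierIntegral_smul_eq_flip (L := innerₗ V)
            Real.continuous_fourierChar continuous_inner s.integrable h1
      _ = ∫ x, g x • 𝓕 f x := by simp only [hs, Complex.coe_smul]

/-- Plancherel's theorem for the Fourier integral of a function in `L¹ ∩ L²`. -/
lemma lintegral_enorm_fourier_sq {f : V → ℂ} (h1 : Integrable f) (h2 : MemLp f 2) :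
    ∫⁻ ξ, ‖𝓕 f ξ‖ₑ ^ 2 = ∫⁻ v, ‖f v‖ₑ ^ 2 := by
  have hsq : ∀ h : V → ℂ, ∫⁻ x, ‖h x‖ₑ ^ 2 = eLpNorm h 2 volume ^ 2 := fun h => by
    rw [eLpNorm_eq_lintegral_rpow_enorm_toReal (by norm_num) (by norm_num), ← ENNReal.rpow_natCast,
      ← ENNReal.rpow_mul]
    simp
  rw [hsq, hsq, ← eLpNorm_congr_ae (fourier_toLp_ae_eq h1 h2), ← eLpNorm_congr_ae h2.coeFn_toLp,
    ← Lp.enorm_def, ← Lp.enorm_def, ← ofReal_norm, Lp.norm_fourier_eq, ofReal_norm]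

end Fourier

/-- The Fourier integral `∫ e^{i t·y} G(t) dt` without normalizing constants. -/
noncomputable def fourierT (G : (Fin n → ℝ) → ℂ) (y : Fin n → ℝ) : ℂ :=
  ∫ t, Complex.exp (Complex.I * (dotR t y : ℂ)) * G t

lemma dotR_comm (t y : Fin n → ℝ) : dotR t y = dotR y t := by
  simp only [dotR, mul_comm]

lemma dotR_smul (c : ℝ) (t y : Fin n → ℝ) : dotR t (c • y) = c * dotR t y := by
  simp only [dotR, Finset.mul_sum, Pi.smul_apply, smul_eq_mul]
  exact Finset.sum_congr rfl fun i _ => by ring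

lemma dotR_neg (t y : Fin n → ℝ) : dotR t (-y) = -dotR t y := by
  simp [dotR]

open FourierTransform in
-- Translates from the kernel `e^{-2πi⟨v,ξ⟩}` on Euclidean space to `e^{i t·y}` on `Fin n → ℝ`; the
-- rescaling by `2π` is the source of all factors `(2π)^n`.
lemma fourier_comp_ofLp (G : (Fin n → ℝ) → ℂ) (ξ : EuclideanSpace ℝ (Fin n)) :
    𝓕 (fun v : EuclideanSpace ℝ (Fin n) => G (WithLp.ofLp v)) ξ =
      fourierT G (-(2 * Real.pi) • WithLp.ofLp ξ) := by
  rw [Real.fourier_eq', fourierT, ← (PiLp.volume_preserving_ofLp (Fin n)).integral_comp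
    (MeasurableEquiv.toLp 2 (Fin n → ℝ)).symm.measurableEmbedding]
  refine integral_congr_ae (.of_forall fun v => ?_)
  have : inner ℝ v ξ = dotR (WithLp.ofLp v) (WithLp.ofLp ξ) := by
    simp [PiLp.inner_apply, dotR, mul_comm]
  simp only [this, dotR_smul, smul_eq_mul]
  congr 2
  push_cast; ring

open FourierTransform in
lemma fourierInv_comp_ofLp (G : (Fin n → ℝ) → ℂ) (ξ : EuclideanSpace ℝ (Fin n)) :
    𝓕⁻ (fun v : EuclideanSpace ℝ (Fin n) => G (WithLp.ofLp v)) ξ =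
      fourierT G ((2 * Real.pi) • WithLp.ofLp ξ) := by
  rw [Real.fourierInv_eq_fourier_neg, fourier_comp_ofLp]
  simp

lemma lintegral_comp_smul_pi (f : (Fin n → ℝ) → ℝ≥0∞) {r : ℝ} (hr : r ≠ 0) :
    ∫⁻ x, f x = ENNReal.ofReal |r| ^ n * ∫⁻ x, f (r • x) := by
  have h := (Homeomorph.smulOfNeZero (α := Fin n → ℝ) r hr).measurableEmbedding.lintegral_map
    (μ := volume) f
  have h2 : Measure.map (Homeomorph.smulOfNeZero (α := Fin n → ℝ) r hr) volume =
    ENNReal.ofReal (abs (r ^ n)⁻¹) • volume := by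
    simpa using Measure.map_addHaar_smul (volume : Measure (Fin n → ℝ)) hr
  rw [h2, lintegral_smul_measure] at h
  change _ = ∫⁻ x, f (r • x) at h
  rw [← h, smul_eq_mul, ← mul_assoc, ← ENNReal.ofReal_pow (abs_nonneg _),
    ← ENNReal.ofReal_mul (by positivity), abs_inv, abs_pow, mul_inv_cancel₀ (by positivity)]
  simp

lemma ofReal_two_pi_ne_zero : ENNReal.ofReal (2 * Real.pi) ^ n ≠ 0 :=
  pow_ne_zero _ (by simpa using Real.pi_pos)

lemma ofReal_two_pi_ne_top : ENNReal.ofReal (2 * Real.pi) ^ n ≠ ∞ :=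
  ENNReal.pow_ne_top ENNReal.ofReal_ne_top

/-- Plancherel's theorem. -/
lemma lintegral_enorm_fourierT_sq {G : (Fin n → ℝ) → ℂ} (h1 : Integrable G) (h2 : MemLp G 2) :
    ∫⁻ y, ‖fourierT G y‖ₑ ^ 2 = ENNReal.ofReal (2 * Real.pi) ^ n * ∫⁻ t, ‖G t‖ₑ ^ 2 := by
  have hp := PiLp.volume_preserving_ofLp (Fin n)
  have he : MeasurableEmbedding (WithLp.ofLp : EuclideanSpace ℝ (Fin n) → _) :=
    (MeasurableEquiv.toLp 2 (Fin n → ℝ)).symm.measurableEmbedding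
  have := lintegral_enorm_fourier_sq (f := fun v : EuclideanSpace ℝ (Fin n) => G (WithLp.ofLp v))
    (hp.integrable_comp_of_integrable h1) (h2.comp_measurePreserving hp)
  rw [hp.lintegral_comp_emb he (fun t => ‖G t‖ₑ ^ 2)] at this
  rw [← this, lintegral_comp_smul_pi _ (r := -(2 * Real.pi)) (by simp [Real.pi_ne_zero]),
    abs_neg, abs_of_pos Real.two_pi_pos, ← hp.lintegral_comp_emb he]
  simp only [fourier_comp_ofLp]

/-- Fourier inversion. -/
lemma fourierT_inversion {F : (Fin n → ℝ) → ℂ} (hF : Continuous F) (h1 : Integrable F)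
    (h2 : Integrable (fourierT F)) (y : Fin n → ℝ) :
    F y = ((2 * Real.pi : ℝ) ^ n)⁻¹ • fourierT (fun t => fourierT F (-t)) y := by
  have hp := PiLp.volume_preserving_ofLp (Fin n)
  have hpi : -(2 * Real.pi) ≠ 0 := by simp [Real.pi_ne_zero]
  have hpt : FourierTransform.fourier (fun v : EuclideanSpace ℝ (Fin n) => F (WithLp.ofLp v)) =
      fun ξ => (fun s => fourierT F (-(2 * Real.pi) • s)) (WithLp.ofLp ξ) :=
    funext (fourier_comp_ofLp F)
  have hinv := Continuous.fourierInv_fourier_eq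
    (f := fun v : EuclideanSpace ℝ (Fin n) => F (WithLp.ofLp v))
    (hF.comp (PiLp.continuous_ofLp 2 _)) (hp.integrable_comp_of_integrable h1) (by
      rw [hpt]
      exact hp.integrable_comp_of_integrable
        (g := fun s => fourierT F (-(2 * Real.pi) • s)) (h2.comp_smul hpi))
  have := congrFun hinv (WithLp.toLp 2 y)
  rw [hpt, fourierInv_comp_ofLp fun s => fourierT F (-(2 * Real.pi) • s)] at this
  simp only at this
  rw [← this, fourierT, fourierT]
  have hs := Measure.integral_comp_smul (volume : Measure (Fin n → ℝ))
    (fun t => Complex.exp (Complex.I * (dotR t y : ℂ)) * fourierT F (-t)) (2 * Real.pi)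
  rw [Module.finrank_fin_fun, abs_of_pos (by positivity)] at hs
  rw [← hs]
  refine integral_congr_ae (.of_forall fun t => ?_)
  simp only [dotR_smul, neg_smul]
  rw [dotR_comm (_ • t), dotR_smul, dotR_comm t]


/-! ### Integration and Plancherel on tubes. -/

/-- The point `x + iy` of `ℂⁿ`. -/
noncomputable def toC (x y : Fin n → ℝ) : Fin n → ℂ := fun i => ⟨x i, y i⟩

/-- The imaginary part `y` of `z = x + iy`. -/
def imPart (z : Fin n → ℂ) : Fin n → ℝ := fun i => (z i).im

@[simp] lemma rePart_toC (x y : Fin n → ℝ) : rePart (toC x y) = x := rfl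
@[simp] lemma imPart_toC (x y : Fin n → ℝ) : imPart (toC x y) = y := rfl
@[simp] lemma toC_rePart_imPart (z : Fin n → ℂ) : toC (rePart z) (imPart z) = z := rfl

lemma toC_eq (x y : Fin n → ℝ) : toC x y = fun i => (x i : ℂ) + y i * Complex.I :=
  funext fun _ => (Complex.mk_eq_add_mul_I _ _)

@[fun_prop]
lemma continuous_toC {X : Type*} [TopologicalSpace X] {f g : X → Fin n → ℝ}
    (hf : Continuous f) (hg : Continuous g) : Continuous fun p => toC (f p) (g p) := by
  simp only [toC_eq]; fun_prop

lemma dotC_toC (t x y : Fin n → ℝ) :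
    dotC t (toC x y) = (dotR t x : ℂ) + Complex.I * (dotR t y : ℂ) := by
  simp only [toC_eq, dotC, dotR, Complex.ofReal_sum, Finset.mul_sum, ← Finset.sum_add_distrib]
  refine Finset.sum_congr rfl fun i _ => ?_
  push_cast; ring

lemma measurePreserving_toC :
    MeasurePreserving (fun p : (Fin n → ℝ) × (Fin n → ℝ) => toC p.1 p.2) := by
  have h1 := volume_preserving_pi
    (fun _ : Fin n => Complex.volume_preserving_equiv_real_prod.symm)
  have h2 := (volume_measurePreserving_arrowProdEquivProdArrow ℝ ℝ (Fin n)).symm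
  exact h1.comp h2

lemma measurableEmbedding_toC :
    MeasurableEmbedding (fun p : (Fin n → ℝ) × (Fin n → ℝ) => toC p.1 p.2) :=
  ((MeasurableEquiv.arrowProdEquivProdArrow ℝ ℝ (Fin n)).symm.trans
    (MeasurableEquiv.piCongrRight fun _ : Fin n =>
      Complex.measurableEquivRealProd.symm)).measurableEmbedding

lemma measurableSet_tube {A : Set (Fin n → ℝ)} (hA : MeasurableSet A) : MeasurableSet (tube A) :=
  (by fun_prop : Continuous fun z : Fin n → ℂ => rePart z).measurable hA

lemma measurePreserving_toC_restrict {A : Set (Fin n → ℝ)} (hA : MeasurableSet A) :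
    MeasurePreserving (fun p : (Fin n → ℝ) × (Fin n → ℝ) => toC p.1 p.2)
      ((volume.restrict A).prod volume) (volume.restrict (tube A)) := by
  have := (measurePreserving_toC (n := n)).restrict_preimage (measurableSet_tube hA)
  have h2 : (fun p : (Fin n → ℝ) × (Fin n → ℝ) => toC p.1 p.2) ⁻¹' tube A = A ×ˢ Set.univ := by
    ext p; simp [tube]
  rw [h2] at this
  rwa [Measure.volume_eq_prod, ← Measure.prod_restrict, Measure.restrict_univ] at this

/-- Tonelli's theorem on a tube. -/
lemma lintegral_tube {A : Set (Fin n → ℝ)} (hA : MeasurableSet A) {F : (Fin n → ℂ) → ℝ≥0∞}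
    (hF : AEMeasurable F (volume.restrict (tube A))) :
    ∫⁻ z in tube A, F z = ∫⁻ x in A, ∫⁻ y, F (toC x y) := by
  have h := measurePreserving_toC_restrict hA
  rw [← h.lintegral_comp_emb measurableEmbedding_toC, lintegral_prod]
  exact measurableEmbedding_toC.aemeasurable_map_iff.1 (h.map_eq.symm ▸ hF)

lemma aemeasurable_comp_rePart {A : Set (Fin n → ℝ)} (hA : MeasurableSet A)
    {ρ : (Fin n → ℝ) → ℝ≥0∞} (hρ : AEMeasurable ρ (volume.restrict A)) :
    AEMeasurable (fun z => ρ (rePart z)) (volume.restrict (tube A)) := by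
  have h := measurePreserving_toC_restrict hA
  rw [← h.map_eq, measurableEmbedding_toC.aemeasurable_map_iff]
  exact hρ.comp_fst

/-- The weighted Plancherel theorem on a tube. -/
lemma lintegral_tube_laplace {A : Set (Fin n → ℝ)} (hA : MeasurableSet A)
    {ρ : (Fin n → ℝ) → ℝ≥0∞} (hρ : AEMeasurable ρ (volume.restrict A))
    {f : (Fin n → ℂ) → ℂ} {g : (Fin n → ℝ) → ℂ} (hgm : AEStronglyMeasurable g volume)
    (hf : ContinuousOn f (tube A))
    (h1 : ∀ x ∈ A, Integrable fun t => (Real.exp (dotR t x) : ℂ) * g t)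
    (h2 : ∀ x ∈ A, MemLp (fun t => (Real.exp (dotR t x) : ℂ) * g t) 2)
    (hfg : ∀ z ∈ tube A, f z = ∫ t, Complex.exp (dotC t z) * g t) :
    ∫⁻ z in tube A, ‖f z‖ₑ ^ 2 * ρ (rePart z) =
      ENNReal.ofReal (2 * Real.pi) ^ n * ∫⁻ t, ‖g t‖ₑ ^ 2 *
        ∫⁻ x in A, ENNReal.ofReal (Real.exp (2 * dotR t x)) * ρ x := by
  have hE : Measurable fun p : (Fin n → ℝ) × (Fin n → ℝ) =>
      ENNReal.ofReal (Real.exp (2 * dotR p.2 p.1)) :=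
    ENNReal.measurable_ofReal.comp (Continuous.measurable (by fun_prop))
  have hE1 : ∀ t : Fin n → ℝ, Measurable fun x : (Fin n → ℝ) =>
      ENNReal.ofReal (Real.exp (2 * dotR t x)) := fun t =>
    ENNReal.measurable_ofReal.comp (Continuous.measurable (by fun_prop))
  -- On the slice over `x`, `f` is the Fourier integral of `e^{t·x} g(t)`, so Plancherel applies.
  have hsl : ∀ x ∈ A, ∫⁻ y, ‖f (toC x y)‖ₑ ^ 2 = ENNReal.ofReal (2 * Real.pi) ^ n *
      ∫⁻ t, ENNReal.ofReal (Real.exp (2 * dotR t x)) * ‖g t‖ₑ ^ 2 := by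
    intro x hx
    have := lintegral_enorm_fourierT_sq (h1 x hx) (h2 x hx)
    rw [show (∫⁻ y, ‖f (toC x y)‖ₑ ^ 2) =
      ∫⁻ y, ‖fourierT (fun t => (Real.exp (dotR t x) : ℂ) * g t) y‖ₑ ^ 2 from ?_, this]
    · congr 1
      refine lintegral_congr fun t => ?_
      rw [enorm_mul, mul_pow, ← ofReal_norm (Real.exp (dotR t x) : ℂ), Complex.norm_real,
        Real.norm_of_nonneg (Real.exp_nonneg _), ← ENNReal.ofReal_pow (Real.exp_nonneg _), two_mul,
        Real.exp_add, sq (Real.exp _)]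
    · refine lintegral_congr fun y => ?_
      rw [hfg _ (show rePart (toC x y) ∈ A from hx), fourierT]
      congr 3
      ext t
      rw [dotC_toC, Complex.exp_add, Complex.ofReal_exp]
      ring
  rw [lintegral_tube hA (F := fun z => ‖f z‖ₑ ^ 2 * ρ (rePart z))
    (((hf.aemeasurable (measurableSet_tube hA)).enorm.pow_const 2).mul
      (aemeasurable_comp_rePart hA hρ))]
  calc ∫⁻ x in A, ∫⁻ y, ‖f (toC x y)‖ₑ ^ 2 * ρ (rePart (toC x y))
      = ∫⁻ x in A, ENNReal.ofReal (2 * Real.pi) ^ n *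
          ∫⁻ t, ENNReal.ofReal (Real.exp (2 * dotR t x)) * ‖g t‖ₑ ^ 2 * ρ x := by
        refine setLIntegral_congr_fun hA fun x hx => ?_
        simp only [rePart_toC]
        rw [lintegral_mul_const'' , hsl x hx, mul_assoc, lintegral_mul_const'']
        · exact ((hE.comp measurable_prodMk_left).aemeasurable).mul (hgm.enorm.pow_const 2)
        · exact (hf.comp_continuous (by fun_prop : Continuous (toC x))
            fun _ => hx).aemeasurable.enorm.pow_const 2
    _ = ENNReal.ofReal (2 * Real.pi) ^ n * ∫⁻ x in A,
          ∫⁻ t, ENNReal.ofReal (Real.exp (2 * dotR t x)) * ‖g t‖ₑ ^ 2 * ρ x :=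
        lintegral_const_mul' _ _ ofReal_two_pi_ne_top
    _ = ENNReal.ofReal (2 * Real.pi) ^ n * ∫⁻ t, ∫⁻ x in A,
          ENNReal.ofReal (Real.exp (2 * dotR t x)) * ‖g t‖ₑ ^ 2 * ρ x := by
        rw [lintegral_lintegral_swap]
        exact (hE.aemeasurable.mul (hgm.enorm.pow_const 2).comp_snd).mul hρ.comp_fst
    _ = _ := by
        congr 1
        refine lintegral_congr fun t => ?_
        rw [← lintegral_const_mul'']
        · exact lintegral_congr fun x => by ring
        · exact (hE1 t).aemeasurable.mul hρ


/-! ### Lower bound for the Bergman space. -/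

lemma measurableSet_finiteInterior (φ : (Fin n → ℝ) → EReal) :
    MeasurableSet (finiteInterior φ) := isOpen_interior.measurableSet

lemma exp_logLaplace (φ : (Fin n → ℝ) → EReal) (t : Fin n → ℝ) :
    EReal.exp (logLaplace φ t) =
      ∫⁻ x, ENNReal.ofReal (Real.exp (2 * dotR t x)) * EReal.exp (-φ x) := by
  simp only [logLaplace, ENNReal.exp_log, exp_coe_sub, EReal.exp_neg]

lemma IsConvexFun.aemeasurable_exp_neg {φ : (Fin n → ℝ) → EReal} (hφ : IsConvexFun φ) :
    AEMeasurable (fun x => EReal.exp (-φ x)) volume := by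
  simp only [EReal.exp_neg]
  exact (EReal.measurable_exp.comp_aemeasurable hφ.aemeasurable).inv

lemma aemeasurable_laplace {ρ : (Fin n → ℝ) → ℝ≥0∞} {A : Set (Fin n → ℝ)}
    (hρ : AEMeasurable ρ (volume.restrict A)) :
    AEMeasurable fun t => ∫⁻ x in A, ENNReal.ofReal (Real.exp (2 * dotR t x)) * ρ x := by
  refine AEMeasurable.lintegral_prod_right'
    (f := fun p : (Fin n → ℝ) × (Fin n → ℝ) =>
      ENNReal.ofReal (Real.exp (2 * dotR p.1 p.2)) * ρ p.2) ?_
  refine AEMeasurable.mul ?_ hρ.comp_snd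
  exact (ENNReal.measurable_ofReal.comp (Continuous.measurable (by fun_prop))).aemeasurable

/-- The integrand is strictly positive where `φ < ∞`. This supplies the nonvanishing weight required
by Cauchy-Schwarz and by the extremal functions. -/
lemma laplace_ne_zero {φ : (Fin n → ℝ) → EReal} (hφ : IsConvexFun φ) {A : Set (Fin n → ℝ)}
    (hAm : MeasurableSet A) (hA : A ⊆ finiteInterior φ) (hA0 : volume A ≠ 0) (t : Fin n → ℝ) :
    ∫⁻ x in A, ENNReal.ofReal (Real.exp (2 * dotR t x)) * EReal.exp (-φ x) ≠ 0 := by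
  intro h
  rw [lintegral_eq_zero_iff'] at h
  · refine hA0 (Measure.restrict_eq_zero.1 (ae_eq_bot.1 (Filter.eventually_false_iff_eq_bot.1 ?_)))
    filter_upwards [h, ae_restrict_mem hAm] with x hx hxA
    have : φ x < ⊤ := interior_subset (s := {x | φ x < ⊤}) (hA hxA)
    have h3 : EReal.exp (-φ x) ≠ 0 := by simpa [EReal.exp_neg] using this.ne
    exact (mul_ne_zero (by simpa using Real.exp_pos _) h3) hx
  · exact (ENNReal.measurable_ofReal.comp (Continuous.measurable (by fun_prop))).aemeasurable.mul
      hφ.aemeasurable_exp_neg.restrict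

/-- Laplace transforms of extremal functions lie in the Bergman space. -/
lemma le_bergmanKernel_bergmanSpace {φ : (Fin n → ℝ) → EReal} (hφ : IsConvexFun φ)
    {z : Fin n → ℂ} (hz : rePart z ∈ finiteInterior φ) :
    (ENNReal.ofReal (2 * Real.pi) ^ n)⁻¹ * ∫⁻ t, EReal.exp
      (((2 * dotR t (rePart z) : ℝ) : EReal) - logLaplace φ t) ≤
      bergmanKernel (bergmanSpace φ) (bergmanNormSq φ) z := by
  simp only [exp_coe_sub]
  set k := ENNReal.ofReal (2 * Real.pi) ^ n with hk
  have hk0 : k ≠ 0 := ofReal_two_pi_ne_zero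
  have hkt : k ≠ ∞ := ofReal_two_pi_ne_top
  have hρ := hφ.aemeasurable_exp_neg
  have ha : AEMeasurable fun t => EReal.exp (logLaplace φ t) := by
    simp only [exp_logLaplace]
    simpa using aemeasurable_laplace (A := Set.univ) hρ.restrict
  have hle : ∀ t, (∫⁻ x in finiteInterior φ,
      ENNReal.ofReal (Real.exp (2 * dotR t x)) * EReal.exp (-φ x)) ≤
      EReal.exp (logLaplace φ t) := fun t => by
    rw [exp_logLaplace]; exact setLIntegral_le_lintegral _ _
  have ha0 : ∀ t, EReal.exp (logLaplace φ t) ≠ 0 := fun t h0 =>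
    laplace_ne_zero hφ (measurableSet_finiteInterior φ) subset_rfl
      (isOpen_interior.measure_pos volume ⟨_, hz⟩).ne' t (le_antisymm (h0 ▸ hle t) zero_le)
  refine le_of_forall_lt fun c hc => ?_
  rw [← ENNReal.div_eq_inv_mul, ENNReal.lt_div_iff_mul_lt (.inl hk0) (.inl hkt)] at hc
  obtain ⟨g, hg, J, hcJ, hJ, h1, h2⟩ := exists_extremal ha (.of_forall ha0) z hc
  have hJ0 : J ≠ 0 := (pos_of_gt hcJ).ne'
  have hdiff := hg.differentiable_laplace.differentiableOn (s := tube (finiteInterior φ))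
  have hb : ∀ x, IsBddSupp fun t => (Real.exp (dotR t x) : ℂ) * g t := fun x =>
    hg.mul_continuous (k := fun t => (Real.exp (dotR t x) : ℂ)) (by fun_prop)
  have hnorm : bergmanNormSq φ (fun z => ∫ t, Complex.exp (dotC t z) * g t) ≤ k * J := by
    rw [bergmanNormSq, lintegral_tube_laplace (measurableSet_finiteInterior φ) hρ.restrict
      (ρ := fun x => EReal.exp (-φ x)) hg.measurable.aestronglyMeasurable hdiff.continuousOn
      (fun x _ => (hb x).integrable) (fun x _ => (hb x).memLp_two) (fun _ _ => rfl), ← h2]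
    gcongr with t
    exact hle t
  refine lt_of_lt_of_le ?_ (le_iSup₂_of_le _ ⟨hdiff, hnorm.trans_lt
    (ENNReal.mul_lt_top hkt.lt_top hJ)⟩ le_rfl)
  rw [h1]
  calc c < J / k := by rwa [ENNReal.lt_div_iff_mul_lt (.inl hk0) (.inl hkt)]
    _ = J ^ 2 / (k * J) := by
      rw [sq, ENNReal.mul_div_mul_right _ _ hJ0 hJ.ne]
    _ ≤ _ := ENNReal.div_le_div_left hnorm _


/-! ### Sub-mean value property and boundedness over compact sets. -/

lemma measurePreserving_circle_smul (u : Circle) :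
    MeasurePreserving (fun v : Fin n → ℂ => (u : ℂ) • v) :=
  volume_preserving_pi (fun _ : Fin n => (rotation u).measurePreserving)

lemma setLIntegral_circle_smul (u : Circle) (r : ℝ) (F : (Fin n → ℂ) → ℝ≥0∞) :
    ∫⁻ v in Metric.closedBall 0 r, F ((u : ℂ) • v) = ∫⁻ v in Metric.closedBall 0 r, F v := by
  have he : MeasurableEmbedding (fun v : Fin n → ℂ => (u : ℂ) • v) :=
    (Homeomorph.smulOfNeZero (α := Fin n → ℂ) (u : ℂ) (Circle.coe_ne_zero u)).measurableEmbedding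
  have := (measurePreserving_circle_smul (n := n) u).setLIntegral_comp_preimage_emb he F
    (Metric.closedBall 0 r)
  rw [← this]
  congr 2
  ext v
  simp [norm_smul, Circle.norm_coe]

/-- The sub-mean value property over a polydisc. -/
lemma volume_mul_enorm_le {U : Set (Fin n → ℂ)} {f : (Fin n → ℂ) → ℂ}
    (hf : DifferentiableOn ℂ f U) {z : Fin n → ℂ} {r : ℝ} (hzr : Metric.closedBall z r ⊆ U) :
    volume (Metric.closedBall (0 : Fin n → ℂ) r) * ‖f z‖ₑ ≤
      ∫⁻ v in Metric.closedBall 0 r, ‖f (z + v)‖ₑ := by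
  set B := Metric.closedBall (0 : Fin n → ℂ) r with hB
  have hmem : ∀ v ∈ B, ∀ l : ℂ, ‖l‖ ≤ 1 → z + l • v ∈ U := fun v hv l hl => hzr (by
    have hv : ‖v‖ ≤ r := by simpa [hB] using hv
    simpa [norm_smul] using (mul_le_of_le_one_left (norm_nonneg v) hl).trans hv)
  -- The one-variable mean value property on the disc `l ↦ z + l v`. Integrating over `v` and
  -- swapping the integrals, each rotation of `v` drops out because it preserves volume and the
  -- polydisc.
  have hcirc : ∀ v ∈ B, ENNReal.ofReal (2 * Real.pi) * ‖f z‖ₑ ≤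
      ∫⁻ θ in Set.Ioc 0 (2 * Real.pi), ‖f (z + (Circle.exp θ : ℂ) • v)‖ₑ := by
    intro v hv
    have hd : DiffContOnCl ℂ (fun l : ℂ => f (z + l • v)) (Metric.ball 0 |1|) := by
      refine DifferentiableOn.diffContOnCl ?_
      rw [abs_one, closure_ball _ one_ne_zero]
      refine hf.comp (by fun_prop) fun l hl => hmem v hv l (by simpa using hl)
    have h := hd.circleAverage
    simp only [zero_smul, add_zero, Real.circleAverage] at h
    have h2 : ∫ θ in (0)..(2 * Real.pi), f (z + (Circle.exp θ : ℂ) • v) = (2 * Real.pi) • f z := by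
      rw [← h, smul_inv_smul₀ Real.two_pi_pos.ne']
      simp [circleMap, Circle.coe_exp]
    rw [intervalIntegral.integral_of_le Real.two_pi_pos.le] at h2
    refine le_trans ?_ (enorm_integral_le_lintegral_enorm _)
    rw [h2, enorm_smul, Real.enorm_eq_ofReal Real.two_pi_pos.le]
  have hmeas : AEMeasurable (fun p : (Fin n → ℂ) × ℝ => ‖f (z + (Circle.exp p.2 : ℂ) • p.1)‖ₑ)
      ((volume.restrict B).prod (volume.restrict (Set.Ioc 0 (2 * Real.pi)))) := by
    rw [Measure.prod_restrict]
    refine AEMeasurable.enorm (ContinuousOn.aemeasurable ?_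
      (Metric.isClosed_closedBall.measurableSet.prod measurableSet_Ioc))
    refine hf.continuousOn.comp (Continuous.continuousOn (by fun_prop)) fun p hp =>
      hmem _ hp.1 _ (by simp)
  have hpi : ENNReal.ofReal (2 * Real.pi) ≠ 0 := by simpa using Real.pi_pos
  rw [← ENNReal.mul_le_mul_iff_right hpi ENNReal.ofReal_ne_top]
  calc ENNReal.ofReal (2 * Real.pi) * (volume B * ‖f z‖ₑ)
      = ∫⁻ _ in B, ENNReal.ofReal (2 * Real.pi) * ‖f z‖ₑ := by
        rw [setLIntegral_const]; ring
    _ ≤ ∫⁻ v in B, ∫⁻ θ in Set.Ioc 0 (2 * Real.pi), ‖f (z + (Circle.exp θ : ℂ) • v)‖ₑ :=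
        setLIntegral_mono' Metric.isClosed_closedBall.measurableSet hcirc
    _ = ∫⁻ θ in Set.Ioc 0 (2 * Real.pi), ∫⁻ v in B, ‖f (z + (Circle.exp θ : ℂ) • v)‖ₑ :=
        lintegral_lintegral_swap hmeas
    _ = ∫⁻ _ in Set.Ioc 0 (2 * Real.pi), ∫⁻ v in B, ‖f (z + v)‖ₑ := by
        refine lintegral_congr fun θ => ?_
        exact setLIntegral_circle_smul (Circle.exp θ) r fun v => ‖f (z + v)‖ₑ
    _ = _ := by
        rw [setLIntegral_const, Real.volume_Ioc, sub_zero, mul_comm]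

lemma norm_rePart_le (z : Fin n → ℂ) : ‖rePart z‖ ≤ ‖z‖ :=
  (pi_norm_le_iff_of_nonneg (norm_nonneg z)).2 fun i =>
    (Complex.abs_re_le_norm (z i)).trans (norm_le_pi_norm z i)

lemma rePart_add (z w : Fin n → ℂ) : rePart (z + w) = rePart z + rePart w := rfl
/-- A convex function is bounded above on compact subsets of the interior of its domain. -/
lemma IsConvexFun.exists_lt_exp_neg {φ : (Fin n → ℝ) → EReal} (hφ : IsConvexFun φ)
    {K : Set (Fin n → ℝ)} (hK : IsCompact K) (hKΩ : K ⊆ finiteInterior φ) :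
    ∃ c : ℝ≥0∞, c ≠ 0 ∧ c ≠ ∞ ∧ ∀ x ∈ K, c ≤ EReal.exp (-φ x) := by
  have hfin : ∀ x ∈ finiteInterior φ, ((φ x).toReal : EReal) = φ x := fun x hx =>
    EReal.coe_toReal (interior_subset (s := {x | φ x < ⊤}) hx).ne (hφ.ne_bot x)
  have hconv : Convex ℝ (finiteInterior φ) := (hφ.convex_lt ⊤).interior
  -- A finite convex function on an open set in finite dimension is continuous, hence bounded on
  -- `K`.
  have hcf : ConvexOn ℝ (finiteInterior φ) fun x => (φ x).toReal := by
    refine ⟨hconv, fun x hx y hy a b ha hb hab => ?_⟩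
    have h := hφ.convex_epigraph (x := (x, (φ x).toReal)) (y := (y, (φ y).toReal))
      (hfin x hx).ge (hfin y hy).ge ha hb hab
    have h' : φ (a • x + b • y) ≤ ((a * (φ x).toReal + b * (φ y).toReal : ℝ) : EReal) := h
    rwa [← hfin _ (hconv hx hy ha hb hab), EReal.coe_le_coe_iff] at h'
  obtain ⟨M, hM⟩ := hK.exists_bound_of_continuousOn
    ((hcf.continuousOn isOpen_interior).mono hKΩ)
  refine ⟨EReal.exp ((-M : ℝ) : EReal), by simp, by simp, fun x hx => ?_⟩
  rw [EReal.exp_le_exp_iff, ← hfin x (hKΩ hx), ← EReal.coe_neg, EReal.coe_le_coe_iff,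
    neg_le_neg_iff]
  exact (le_abs_self _).trans (hM x hx)

/-- Functions in the Bergman space are bounded on tubes over compact sets. -/
lemma exists_norm_le_of_mem_bergmanSpace {φ : (Fin n → ℝ) → EReal} (hφ : IsConvexFun φ)
    {f : (Fin n → ℂ) → ℂ} (hf : f ∈ bergmanSpace φ) {K : Set (Fin n → ℝ)} (hK : IsCompact K)
    (hKΩ : K ⊆ finiteInterior φ) : ∃ C : ℝ, ∀ z ∈ tube K, ‖f z‖ ≤ C := by
  -- One radius `δ` serves every point of the tube, and the weight depends only on `x`, so the bound
  -- is uniform in `y`.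
  obtain ⟨δ, hδ, hδΩ⟩ := hK.exists_cthickening_subset_open isOpen_interior hKΩ
  obtain ⟨c, hc0, hct, hc⟩ := hφ.exists_lt_exp_neg hK.cthickening hδΩ
  set V := volume (Metric.closedBall (0 : Fin n → ℂ) δ)
  have hV0 : V ≠ 0 := (Metric.measure_closedBall_pos volume _ hδ).ne'
  have hVt : V ≠ ∞ := measure_closedBall_lt_top.ne
  set D : ℝ≥0∞ := bergmanNormSq φ f / (c * V) with hD
  have hDt : D ≠ ∞ := ENNReal.div_ne_top hf.2.ne (mul_ne_zero hc0 hV0)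
  refine ⟨√D.toReal, fun z hz => Real.le_sqrt_of_sq_le ?_⟩
  have hball : ∀ v ∈ Metric.closedBall (0 : Fin n → ℂ) δ,
      rePart (z + v) ∈ Metric.cthickening δ K := fun v hv =>
    Metric.mem_cthickening_of_dist_le _ (rePart z) _ _ hz (by
      rw [rePart_add, dist_self_add_left]
      exact (norm_rePart_le v).trans (by simpa using hv))
  have hsub : Metric.closedBall z δ ⊆ tube (finiteInterior φ) := fun w hw => by
    have := hδΩ (hball (w - z) (by simpa [dist_eq_norm] using hw))
    rwa [add_sub_cancel] at this
  -- Applied to the holomorphic function `f²`, which gives an `L²` estimate directly.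
  have h1 := volume_mul_enorm_le (hf.1.pow 2) hsub
  have h2 : c * ∫⁻ v in Metric.closedBall 0 δ, ‖(f ^ 2) (z + v)‖ₑ ≤ bergmanNormSq φ f := by
    rw [← lintegral_const_mul' _ _ hct]
    calc ∫⁻ v in Metric.closedBall 0 δ, c * ‖(f ^ 2) (z + v)‖ₑ
        ≤ ∫⁻ v in Metric.closedBall 0 δ, ‖f (z + v)‖ₑ ^ 2 * EReal.exp (-φ (rePart (z + v))) := by
          refine setLIntegral_mono' Metric.isClosed_closedBall.measurableSet fun v hv => ?_
          rw [Pi.pow_apply, enorm_pow, mul_comm]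
          gcongr
          exact hc _ (hball v hv)
      _ = ∫⁻ w in Metric.closedBall z δ, ‖f w‖ₑ ^ 2 * EReal.exp (-φ (rePart w)) := by
          have := (measurePreserving_add_left volume z).setLIntegral_comp_preimage_emb
            (measurableEmbedding_addLeft z)
            (fun w => ‖f w‖ₑ ^ 2 * EReal.exp (-φ (rePart w))) (Metric.closedBall z δ)
          rw [← this]
          congr 2
          ext v
          simp
      _ ≤ _ := lintegral_mono_set hsub
  have h3 : ‖f z‖ₑ ^ 2 ≤ D := by
    rw [hD, ENNReal.le_div_iff_mul_le (.inl (mul_ne_zero hc0 hV0)) (.inl (ENNReal.mul_ne_top hct hVt))]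
    calc ‖f z‖ₑ ^ 2 * (c * V) = c * (V * ‖(f ^ 2) z‖ₑ) := by
          rw [Pi.pow_apply, enorm_pow]; ring
      _ ≤ _ := (mul_le_mul_right h1 c).trans h2
  have := ENNReal.toReal_mono hDt h3
  simpa using this


/-! ### Contour shifting for functions with Gaussian decay. -/

/-- Gaussian decay in the imaginary directions, locally uniformly in the real directions. -/
def HasGaussianDecay (ε : ℝ) (Ω : Set (Fin n → ℝ)) (h : (Fin n → ℂ) → ℂ) : Prop :=
  ∀ K ⊆ Ω, IsCompact K →
    ∃ C : ℝ, 0 ≤ C ∧ ∀ z ∈ tube K, ‖h z‖ ≤ C * Real.exp (-ε * ∑ i, imPart z i ^ 2)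

lemma integrable_exp_neg_mul_sum_sq {ε : ℝ} (hε : 0 < ε) :
    Integrable fun y : Fin n → ℝ => Real.exp (-ε * ∑ i, y i ^ 2) := by
  simp only [Finset.mul_sum, Real.exp_sum]
  exact Integrable.fintype_prod (ι := Fin n) (f := fun _ (s : ℝ) => Real.exp (-ε * s ^ 2))
    (fun _ => integrable_exp_neg_mul_sq hε)

lemma HasGaussianDecay.integrable {ε : ℝ} (hε : 0 < ε) {Ω : Set (Fin n → ℝ)}
    {h : (Fin n → ℂ) → ℂ} (hd : HasGaussianDecay ε Ω h) (hc : ContinuousOn h (tube Ω))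
    {x : Fin n → ℝ} (hx : x ∈ Ω) : Integrable fun y => h (toC x y) := by
  obtain ⟨C, -, hC⟩ := hd {x} (by simpa using hx) isCompact_singleton
  exact ((integrable_exp_neg_mul_sum_sq hε).const_mul C).mono'
    (hc.comp_continuous (by fun_prop) fun _ => hx).aestronglyMeasurable
    (.of_forall fun y => hC (toC x y) (Set.mem_singleton x))

/-- Integrals of dominated families of holomorphic functions are holomorphic. -/
lemma differentiableAt_integral_of_dominated {Y : Type*} [MeasurableSpace Y] {μ : Measure Y}
    {F : ℂ → Y → ℂ} {b : Y → ℝ} {r : ℝ} (hr0 : 0 < r)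
    (hmeas : ∀ l : ℂ, ‖l‖ ≤ 2 * r → AEStronglyMeasurable (F l) μ)
    (hF : ∀ y, DifferentiableOn ℂ (fun l => F l y) (Metric.closedBall 0 (2 * r)))
    (hbound : ∀ l : ℂ, ‖l‖ ≤ 2 * r → ∀ y, ‖F l y‖ ≤ b y) (hb : Integrable b μ) :
    DifferentiableAt ℂ (fun l => ∫ y, F l y ∂μ) 0 := by
  have h0 : ‖(0 : ℂ)‖ ≤ 2 * r := by simp; positivity
  have hFd : ∀ y, ∀ l ∈ Metric.ball (0 : ℂ) r, DifferentiableAt ℂ (fun l => F l y) l :=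
    fun y l hl => (hF y).differentiableAt (Filter.mem_of_superset
      (Metric.isOpen_ball.mem_nhds (x := l) (Metric.ball_subset_ball (by linarith) hl))
      Metric.ball_subset_closedBall)
  refine (hasDerivAt_integral_of_dominated_loc_of_deriv_le (μ := μ)
    (F := F) (F' := fun l y => deriv (fun l => F l y) l) (x₀ := 0)
    (bound := fun y => b y / r)
    (Metric.ball_mem_nhds 0 hr0)
    (Filter.mem_of_superset (Metric.ball_mem_nhds 0 hr0) fun l hl =>
      hmeas l ((mem_ball_zero_iff.1 hl).le.trans (by linarith)))
    (hb.mono' (hmeas 0 h0) (.of_forall (hbound 0 h0)))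
    ?_ ?_ (hb.div_const r) (.of_forall fun y l hl => (hFd y l hl).hasDerivAt)).2.differentiableAt
  -- The derivative at `0` is measurable in `y` as a limit of difference quotients along `r / (m +
  -- 1)`.
  · have hseq : Filter.Tendsto (fun m : ℕ => ((r / (m + 1) : ℝ) : ℂ)) Filter.atTop
        (nhdsWithin 0 {0}ᶜ) := by
      refine tendsto_nhdsWithin_iff.2 ⟨?_, .of_forall fun m => ?_⟩
      · rw [← Complex.ofReal_zero]
        refine (Complex.continuous_ofReal.tendsto 0).comp ?_
        exact tendsto_const_nhds.div_atTop
          (Filter.tendsto_atTop_add_const_right _ _ tendsto_natCast_atTop_atTop)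
      · simp only [Set.mem_compl_iff, Set.mem_singleton_iff, Complex.ofReal_eq_zero]
        positivity
    refine aestronglyMeasurable_of_tendsto_ae Filter.atTop
      (f := fun (m : ℕ) y => slope (fun l => F l y) 0 ((r / (m + 1) : ℝ) : ℂ))
      (fun m => ?_) (.of_forall fun y => ?_)
    · have hm : ‖((r / (m + 1) : ℝ) : ℂ)‖ ≤ 2 * r := by
        rw [Complex.norm_real, Real.norm_of_nonneg (by positivity)]
        refine (div_le_self hr0.le (by linarith [(Nat.cast_nonneg m : (0 : ℝ) ≤ m)])).trans ?_
        linarith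
      simp only [slope, vsub_eq_sub]
      exact ((hmeas _ hm).sub (hmeas 0 h0)).const_smul (((r / (m + 1) : ℝ) : ℂ) - 0)⁻¹
    · exact ((hFd y 0 (Metric.mem_ball_self hr0)).hasDerivAt.tendsto_slope).comp hseq
  · refine .of_forall fun y l hl => ?_
    have hsub : Metric.closedBall l r ⊆ Metric.closedBall (0 : ℂ) (2 * r) :=
      Metric.closedBall_subset_closedBall' (by
        have := (mem_ball_zero_iff.1 hl).le
        rw [dist_zero_right]; linarith)
    -- Cauchy's estimate on a circle of radius `r`; this is why the hypotheses reach out to radius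
    -- `2r`.
    refine Complex.norm_deriv_le_of_forall_mem_sphere_norm_le hr0 ?_ fun w hw => ?_
    · exact DifferentiableOn.diffContOnCl
        ((hF y).mono ((Metric.closure_ball_subset_closedBall).trans hsub))
    · exact hbound w (by simpa using hsub (Metric.sphere_subset_closedBall hw)) y

/-- The derivative of `∫ h(x + iy) dy` in a real direction vanishes. -/
lemma hasDerivAt_integral_toC {ε : ℝ} (hε : 0 < ε) {Ω : Set (Fin n → ℝ)} (hΩ : IsOpen Ω)
    {h : (Fin n → ℂ) → ℂ} (hh : DifferentiableOn ℂ h (tube Ω)) (hd : HasGaussianDecay ε Ω h)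
    {x : Fin n → ℝ} (hx : x ∈ Ω) (u : Fin n → ℝ) :
    HasDerivAt (fun s : ℝ => ∫ y, h (toC (x + s • u) y)) 0 0 := by
  obtain ⟨R, hR, hRΩ⟩ := Metric.nhds_basis_closedBall.mem_iff.1 (hΩ.mem_nhds hx)
  obtain ⟨C, hC0, hC⟩ := hd _ hRΩ (isCompact_closedBall x R)
  -- The `+ 1` covers `u = 0`.
  set r : ℝ := R / (2 * (‖u‖ + 1)) with hr
  have hr0 : 0 < r := by positivity
  have hru : 2 * r * ‖u‖ ≤ R := by
    have : 2 * r * (‖u‖ + 1) = R := by rw [hr]; field_simp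
    nlinarith
  set P : ℂ → (Fin n → ℝ) → (Fin n → ℂ) := fun l y => toC (x + l.re • u) (y + l.im • u) with hP
  have hPeq : ∀ l y, P l y = toC x y + l • toC u 0 := by
    intro l y
    ext i
    apply Complex.ext <;> simp [hP, toC]
  have hmem : ∀ l : ℂ, ‖l‖ ≤ 2 * r → x + l.re • u ∈ Metric.closedBall x R := fun l hl => by
    rw [mem_closedBall_iff_norm, add_sub_cancel_left, norm_smul, Real.norm_eq_abs]
    exact (mul_le_mul_of_nonneg_right ((Complex.abs_re_le_norm l).trans hl)
      (norm_nonneg u)).trans hru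
  set Q : ℝ := ∑ i, u i ^ 2 with hQ
  set C' : ℝ := C * Real.exp (ε * (2 * r) ^ 2 * Q) with hC'
  -- The shift of `y` by `l.im • u` costs half the exponent: `(a + b)² ≥ a²/2 - b²`.
  have hbound : ∀ l : ℂ, ‖l‖ ≤ 2 * r → ∀ y,
      ‖h (P l y)‖ ≤ C' * Real.exp (-(ε / 2) * ∑ i, y i ^ 2) := by
    intro l hl y
    refine (hC (P l y) (hmem l hl)).trans ?_
    rw [hC', mul_assoc, ← Real.exp_add]
    refine mul_le_mul_of_nonneg_left (Real.exp_le_exp.2 ?_) hC0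
    have h1 : ∀ i, imPart (P l y) i = y i + l.im * u i := fun i => by simp [hP]
    have h2 : l.im ^ 2 ≤ (2 * r) ^ 2 := by
      rw [← sq_abs]
      exact pow_le_pow_left₀ (abs_nonneg _) ((Complex.abs_im_le_norm l).trans hl) 2
    have h3 : (∑ i, y i ^ 2) / 2 - (2 * r) ^ 2 * Q ≤ ∑ i, imPart (P l y) i ^ 2 := by
      rw [hQ, Finset.mul_sum, Finset.sum_div, ← Finset.sum_sub_distrib]
      refine Finset.sum_le_sum fun i _ => ?_
      rw [h1]
      nlinarith [mul_le_mul_of_nonneg_right h2 (sq_nonneg (u i)), sq_nonneg (y i + 2 * (l.im * u i))]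
    nlinarith
  have hF : ∀ y, DifferentiableOn ℂ (fun l => h (P l y)) (Metric.closedBall 0 (2 * r)) := fun y => by
    simp only [hPeq]
    refine hh.comp (by fun_prop) fun l hl => ?_
    rw [← hPeq]
    exact hRΩ (hmem l (by simpa using hl))
  have hcont : ∀ l : ℂ, ‖l‖ ≤ 2 * r → Continuous fun y => h (P l y) := fun l hl =>
    hh.continuousOn.comp_continuous (by fun_prop) fun y => hRΩ (hmem l hl)
  have hγ := (integrable_exp_neg_mul_sum_sq (n := n) (half_pos hε))
  have hd0 := (differentiableAt_integral_of_dominated (μ := volume) hr0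
    (fun l hl => (hcont l hl).aestronglyMeasurable) hF hbound (hγ.const_mul C')).hasDerivAt
  set g' := deriv (fun l => ∫ y, h (P l y)) 0
  -- An imaginary `l` merely translates `y`, so the integral is constant along the imaginary axis.
  -- Being complex differentiable in `l` at `0`, it has zero derivative there, in real directions
  -- too.
  have htrans : ∀ s : ℝ, ∫ y, h (P (s * Complex.I) y) = ∫ y, h (P 0 y) := by
    intro s
    have : ∀ y, P (s * Complex.I) y = P 0 (y + s • u) := fun y => by simp [hP]
    simp only [this]
    exact integral_add_right_eq_self (fun y => h (P 0 y)) _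
  have hI : HasDerivAt (fun s : ℝ => ∫ y, h (P (s * Complex.I) y)) (g' * Complex.I) 0 := by
    have h1 : HasDerivAt (fun s : ℝ => (s : ℂ) * Complex.I) Complex.I 0 := by
      simpa using (Complex.ofRealCLM.hasDerivAt (x := 0)).mul_const Complex.I
    exact HasDerivAt.comp (h₂ := fun l => ∫ y, h (P l y)) 0 (by simpa using hd0) h1
  simp only [htrans] at hI
  have hg0 : g' = 0 := by
    simpa using hI.unique (hasDerivAt_const (0 : ℝ) (∫ y, h (P 0 y)))
  have hre := HasDerivAt.comp_ofReal (z := 0) (by simpa using hd0)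
  rw [hg0] at hre
  simpa [hP] using hre

/-- The integral of a decaying holomorphic function over `x + iℝⁿ` does not depend on `x`. -/
lemma integral_toC_eq {ε : ℝ} (hε : 0 < ε) {Ω : Set (Fin n → ℝ)} (hΩ : IsOpen Ω)
    (hconv : Convex ℝ Ω) {h : (Fin n → ℂ) → ℂ} (hh : DifferentiableOn ℂ h (tube Ω))
    (hd : HasGaussianDecay ε Ω h) {x₀ x₁ : Fin n → ℝ} (h₀ : x₀ ∈ Ω) (h₁ : x₁ ∈ Ω) :
    ∫ y, h (toC x₁ y) = ∫ y, h (toC x₀ y) := by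
  have hder : ∀ s ∈ Set.Icc (0 : ℝ) 1,
      HasDerivAt (fun s : ℝ => ∫ y, h (toC (x₀ + s • (x₁ - x₀)) y)) 0 s := by
    intro s hs
    have hmem : x₀ + s • (x₁ - x₀) ∈ Ω := hconv.add_smul_sub_mem h₀ h₁ hs
    have := hasDerivAt_integral_toC hε hΩ hh hd hmem (x₁ - x₀)
    have h2 := HasDerivAt.comp_sub_const (f := fun s' : ℝ =>
      ∫ y, h (toC (x₀ + s • (x₁ - x₀) + s' • (x₁ - x₀)) y)) s s (by simpa using this)
    refine h2.congr_of_eventuallyEq (.of_forall fun s' => ?_)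
    simp only [add_assoc, ← add_smul, add_sub_cancel]
  have := constant_of_has_deriv_right_zero (a := (0 : ℝ)) (b := 1)
    (fun s hs => (hder s hs).continuousAt.continuousWithinAt)
    (fun s hs => (hder s ⟨hs.1, hs.2.le⟩).hasDerivWithinAt) 1 (by simp)
  simpa using this


/-! ### Laplace representation. -/

lemma integrable_exp_neg_mul_sum_abs {δ : ℝ} (hδ : 0 < δ) :
    Integrable fun t : Fin n → ℝ => Real.exp (-δ * ∑ i, |t i|) := by
  have h1 : Integrable fun s : ℝ => Real.exp (-δ * |s|) := by
    rw [← integrableOn_univ, ← Set.Iic_union_Ioi (a := (0 : ℝ))]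
    refine IntegrableOn.union ?_ ?_
    · refine (integrableOn_exp_mul_Iic hδ 0).congr_fun (fun s hs => ?_) measurableSet_Iic
      simp only [abs_of_nonpos (show s ≤ 0 from hs)]; ring_nf
    · refine (integrableOn_exp_mul_Ioi (neg_lt_zero.2 hδ) 0).congr_fun (fun s hs => ?_)
        measurableSet_Ioi
      simp only [abs_of_pos (show 0 < s from hs)]
  simp only [Finset.mul_sum, Real.exp_sum]
  exact Integrable.fintype_prod (ι := Fin n) (f := fun _ (s : ℝ) => Real.exp (-δ * |s|))
    (fun _ => h1)

/-- The vector with entries `±δ` whose signs are those of the entries of `t`. -/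
noncomputable def signVec (δ : ℝ) (t : Fin n → ℝ) : Fin n → ℝ := fun i => if 0 ≤ t i then δ else -δ

lemma dotR_add (t x y : Fin n → ℝ) : dotR t (x + y) = dotR t x + dotR t y := by
  simp only [dotR, Pi.add_apply, mul_add, Finset.sum_add_distrib]

/-- This shift maximizes `t · v` over the sup-norm ball of radius `δ`. Moving the base point by it
yields exponential decay in `t`. -/
lemma dotR_signVec (δ : ℝ) (t : Fin n → ℝ) : dotR t (signVec δ t) = δ * ∑ i, |t i| := by
  rw [dotR, Finset.mul_sum]
  refine Finset.sum_congr rfl fun i _ => ?_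
  unfold signVec
  split_ifs with h
  · rw [abs_of_nonneg h, mul_comm]
  · rw [abs_of_neg (not_le.1 h)]; ring

lemma norm_signVec_le {δ : ℝ} (hδ : 0 ≤ δ) (t : Fin n → ℝ) : ‖signVec δ t‖ ≤ δ := by
  refine (pi_norm_le_iff_of_nonneg hδ).2 fun i => ?_
  unfold signVec
  split_ifs <;> simp [abs_of_nonneg hδ]

lemma abs_dotR_le (t v : Fin n → ℝ) : |dotR t v| ≤ ‖v‖ * ∑ i, |t i| := by
  rw [dotR, Finset.mul_sum]
  refine (Finset.abs_sum_le_sum_abs _ _).trans (Finset.sum_le_sum fun i _ => ?_)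
  rw [abs_mul, mul_comm]
  exact mul_le_mul_of_nonneg_right (norm_le_pi_norm v i) (abs_nonneg _)

lemma norm_exp_I_mul (s : ℝ) : ‖Complex.exp (Complex.I * (s : ℂ))‖ = 1 := by
  rw [mul_comm, Complex.norm_exp_ofReal_mul_I]

lemma continuous_fourierT {G : (Fin n → ℝ) → ℂ} (hG : Integrable G) : Continuous (fourierT G) := by
  refine continuous_of_dominated (bound := fun t => ‖G t‖) (fun y => ?_) (fun y => ?_) hG.norm
    (.of_forall fun t => by fun_prop)
  · exact (Continuous.aestronglyMeasurable (by fun_prop)).mul hG.1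
  · exact .of_forall fun t => by rw [norm_mul, norm_exp_I_mul, one_mul]

lemma norm_fourierT_le (G : (Fin n → ℝ) → ℂ) (y : Fin n → ℝ) : ‖fourierT G y‖ ≤ ∫ t, ‖G t‖ := by
  refine (norm_integral_le_integral_norm _).trans_eq (integral_congr_ae (.of_forall fun t => ?_))
  simp only [norm_mul, norm_exp_I_mul, one_mul]

/-- A decaying holomorphic function on a tube is the Laplace transform of a function. -/
lemma exists_eq_laplace {ε : ℝ} (hε : 0 < ε) {Ω : Set (Fin n → ℝ)} (hΩ : IsOpen Ω)
    (hconv : Convex ℝ Ω) (hne : Ω.Nonempty) {F : (Fin n → ℂ) → ℂ}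
    (hF : DifferentiableOn ℂ F (tube Ω)) (hd : HasGaussianDecay ε Ω F) :
    ∃ g : (Fin n → ℝ) → ℂ, AEStronglyMeasurable g volume ∧
      (∀ x ∈ Ω, Integrable fun t => (Real.exp (dotR t x) : ℂ) * g t) ∧
      (∀ x ∈ Ω, MemLp (fun t => (Real.exp (dotR t x) : ℂ) * g t) 2) ∧
      ∀ z ∈ tube Ω, F z = ∫ t, Complex.exp (dotC t z) * g t := by
  obtain ⟨x₀, hx₀⟩ := hne
  set p : ℂ := ((((2 * Real.pi : ℝ) ^ n)⁻¹ : ℝ) : ℂ) with hp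
  set c : (Fin n → ℝ) → ℂ := fun t =>
    ∫ y, F (toC x₀ y) * Complex.exp (-dotC t (toC x₀ y)) with hc
  have hint : ∀ x ∈ Ω, Integrable fun y => F (toC x y) := fun x hx =>
    hd.integrable hε hF.continuousOn hx
  -- By contour shifting, `c` may be computed on any slice `x` instead of `x₀`, so a single `c`
  -- serves the whole tube.
  have key : ∀ x ∈ Ω, ∀ t, (Real.exp (dotR t x) : ℂ) * c t =
      fourierT (fun y => F (toC x y)) (-t) := by
    intro x hx t
    have hdiff : DifferentiableOn ℂ (fun z => F z * Complex.exp (-dotC t z)) (tube Ω) := by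
      refine hF.mul (DifferentiableOn.cexp ?_)
      simp only [← dotL_apply]
      fun_prop
    have hdec : HasGaussianDecay ε Ω fun z => F z * Complex.exp (-dotC t z) := by
      intro K hK hKc
      obtain ⟨C, hC0, hC⟩ := hd K hK hKc
      obtain ⟨D, hD⟩ := hKc.exists_bound_of_continuousOn
        (f := fun x => Real.exp (-dotR t x)) (by fun_prop)
      have hD0 : 0 ≤ |D| := abs_nonneg _
      refine ⟨C * |D|, by positivity, fun z hz => ?_⟩
      rw [norm_mul, Complex.norm_exp, Complex.neg_re, re_dotC, mul_right_comm]
      refine mul_le_mul (hC z hz) ?_ (Real.exp_nonneg _) (by positivity)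
      exact (Real.le_norm_self _).trans ((hD _ hz).trans (le_abs_self D))
    simp only [hc]
    rw [← integral_toC_eq hε hΩ hconv hdiff hdec hx₀ hx, ← integral_const_mul, fourierT]
    refine integral_congr_ae (.of_forall fun y => ?_)
    simp only [dotC_toC, dotR_neg, dotR_comm y t, neg_add, Complex.exp_add, Complex.ofReal_exp,
      Complex.ofReal_neg]
    have : Complex.exp (dotR t x : ℂ) * Complex.exp (-(dotR t x : ℂ)) = 1 := by
      rw [← Complex.exp_add]; simp
    rw [mul_neg]
    linear_combination (F (toC x y) * Complex.exp (-(Complex.I * (dotR t y : ℂ)))) * this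
  have hcont : ∀ x ∈ Ω, Continuous fun t => (Real.exp (dotR t x) : ℂ) * c t := fun x hx => by
    simp only [key x hx]
    exact (continuous_fourierT (hint x hx)).comp continuous_neg
  -- The transform is bounded uniformly over base points near `x`; evaluating at `x + signVec δ t`
  -- gains the factor `e^{-δ ∑ |tᵢ|}` at `x`.
  have hbound : ∀ x ∈ Ω, ∃ δ > 0, ∃ D : ℝ, 0 ≤ D ∧ ∀ t,
      ‖(Real.exp (dotR t x) : ℂ) * c t‖ ≤ D * Real.exp (-δ * ∑ i, |t i|) := by
    intro x hx
    obtain ⟨δ, hδ, hδΩ⟩ := Metric.nhds_basis_closedBall.mem_iff.1 (hΩ.mem_nhds hx)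
    obtain ⟨C, hC0, hC⟩ := hd _ hδΩ (isCompact_closedBall x δ)
    set S : ℝ := ∫ y : Fin n → ℝ, C * Real.exp (-ε * ∑ i, y i ^ 2)
    refine ⟨δ, hδ, S, integral_nonneg fun y => by positivity, fun t => ?_⟩
    have hmem : x + signVec δ t ∈ Metric.closedBall x δ := by
      simpa [mem_closedBall_iff_norm] using norm_signVec_le hδ.le t
    have h1 : ‖(Real.exp (dotR t (x + signVec δ t)) : ℂ) * c t‖ ≤ S := by
      rw [key _ (hδΩ hmem)]
      refine (norm_fourierT_le _ _).trans (integral_mono (hint _ (hδΩ hmem)).norm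
        ((integrable_exp_neg_mul_sum_sq hε).const_mul C) fun y => hC _ hmem)
    rw [dotR_add, dotR_signVec, Real.exp_add, Complex.ofReal_mul, mul_right_comm, norm_mul,
      Complex.norm_real, Real.norm_of_nonneg (Real.exp_nonneg _)] at h1
    rw [neg_mul, Real.exp_neg, ← div_eq_mul_inv, le_div_iff₀ (Real.exp_pos _)]
    exact h1
  have hintc : ∀ x ∈ Ω, Integrable fun t => (Real.exp (dotR t x) : ℂ) * c t := fun x hx => by
    obtain ⟨δ, hδ, D, -, hD⟩ := hbound x hx
    exact ((integrable_exp_neg_mul_sum_abs hδ).const_mul D).mono' (hcont x hx).aestronglyMeasurable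
      (.of_forall hD)
  have hlpc : ∀ x ∈ Ω, MemLp (fun t => (Real.exp (dotR t x) : ℂ) * c t) 2 := fun x hx => by
    obtain ⟨δ, hδ, D, hD0, hD⟩ := hbound x hx
    refine (memLp_two_iff_integrable_sq_norm (hcont x hx).aestronglyMeasurable).2 ?_
    have hle : ∀ t, ‖(Real.exp (dotR t x) : ℂ) * c t‖ ≤ D := fun t => (hD t).trans
      (mul_le_of_le_one_right hD0 (Real.exp_le_one_iff.2 (by
        have : 0 ≤ ∑ i, |t i| := Finset.sum_nonneg fun i _ => abs_nonneg _
        nlinarith)))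
    have := (hintc x hx).norm.bdd_mul (c := D) (hintc x hx).norm.1
      (.of_forall fun t => by simpa using hle t)
    simpa only [← sq] using this
  have hcomm : ∀ x t, (Real.exp (dotR t x) : ℂ) * (p * c t) =
      p * ((Real.exp (dotR t x) : ℂ) * c t) := fun x t => by ring
  refine ⟨fun t => p * c t, ?_, fun x hx => ?_, fun x hx => ?_, fun z hz => ?_⟩
  · have : (fun t => p * c t) = fun t =>
        p * ((Real.exp (-dotR t x₀) : ℂ) * ((Real.exp (dotR t x₀) : ℂ) * c t)) := by
      ext t
      rw [← mul_assoc (Real.exp _ : ℂ), ← Complex.ofReal_mul, ← Real.exp_add]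
      simp
    rw [this]
    exact (continuous_const.mul (Continuous.mul (by fun_prop) (hcont x₀ hx₀))).aestronglyMeasurable
  · simp only [hcomm]; exact (hintc x hx).const_mul p
  · simp only [hcomm]; exact (hlpc x hx).const_mul p
  · have hinv := fourierT_inversion (F := fun y => F (toC (rePart z) y))
      (hF.continuousOn.comp_continuous (by fun_prop) fun _ => hz) (hint _ hz) (by
        have := hintc _ hz
        simp only [key _ hz] at this
        simpa using this.comp_neg) (imPart z)
    simp only [toC_rePart_imPart] at hinv
    rw [hinv, fourierT, Complex.real_smul, ← integral_const_mul]
    refine integral_congr_ae (.of_forall fun t => ?_)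
    simp only
    rw [← key _ hz, ← toC_rePart_imPart z, dotC_toC, Complex.exp_add, Complex.ofReal_exp]
    simp only [rePart_toC, imPart_toC, hp]
    ring


/-! ### Upper bound for the Bergman space. -/

/-- The sum `∑ (zᵢ - wᵢ)²`. -/
noncomputable def sqSum (w z : Fin n → ℂ) : ℂ := ∑ i, (z i - w i) ^ 2

lemma re_sqSum (w z : Fin n → ℂ) : (sqSum w z).re =
    ∑ i, (rePart z i - rePart w i) ^ 2 - ∑ i, (imPart z i - imPart w i) ^ 2 := by
  simp only [sqSum, Complex.re_sum, ← Finset.sum_sub_distrib]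
  refine Finset.sum_congr rfl fun i _ => ?_
  simp [sq, rePart, imPart]

/-- The real part of the exponent is `ε` times the squared real distance, bounded on `K`, minus the
squared imaginary distance. Recentring the latter at `0` halves `ε`. -/
lemma hasGaussianDecay_mul_exp_sqSum {ε : ℝ} (hε : 0 < ε) {Ω : Set (Fin n → ℝ)}
    {f : (Fin n → ℂ) → ℂ} (hf : ∀ K ⊆ Ω, IsCompact K → ∃ C : ℝ, ∀ z ∈ tube K, ‖f z‖ ≤ C)
    (w : Fin n → ℂ) :
    HasGaussianDecay (ε / 2) Ω fun z => f z * Complex.exp (ε * sqSum w z) := by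
  intro K hK hKc
  obtain ⟨C, hC⟩ := hf K hK hKc
  obtain ⟨M, hM⟩ := hKc.exists_bound_of_continuousOn
    (f := fun x => ∑ i, (x i - rePart w i) ^ 2) (by fun_prop)
  set Q := ∑ i, imPart w i ^ 2 with hQ
  refine ⟨|C| * Real.exp (ε * (M + Q)), by positivity, fun z hz => ?_⟩
  rw [norm_mul, Complex.norm_exp, mul_assoc, ← Real.exp_add]
  refine mul_le_mul ((hC z hz).trans (le_abs_self C)) (Real.exp_le_exp.2 ?_) (Real.exp_nonneg _)
    (abs_nonneg _)
  rw [Complex.re_ofReal_mul, re_sqSum]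
  have h1 := (Real.le_norm_self _).trans (hM _ hz)
  have h2 : (∑ i, imPart z i ^ 2) / 2 - Q ≤ ∑ i, (imPart z i - imPart w i) ^ 2 := by
    rw [hQ, Finset.sum_div, ← Finset.sum_sub_distrib]
    refine Finset.sum_le_sum fun i _ => ?_
    nlinarith [sq_nonneg (imPart z i - 2 * imPart w i)]
  nlinarith

/-- The Bergman kernel estimate for the Laplace transform of a compact part of the weight. -/
lemma enorm_sq_le_of_isCompact {φ : (Fin n → ℝ) → EReal} (hφ : IsConvexFun φ)
    {f : (Fin n → ℂ) → ℂ} (hf : f ∈ bergmanSpace φ) {K : Set (Fin n → ℝ)} (hK : IsCompact K)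
    (hKΩ : K ⊆ finiteInterior φ) (hK0 : volume K ≠ 0) {z : Fin n → ℂ} (hz : rePart z ∈ K) :
    ‖f z‖ₑ ^ 2 ≤ (ENNReal.ofReal (2 * Real.pi) ^ n)⁻¹ * bergmanNormSq φ f *
      ∫⁻ t, ENNReal.ofReal (Real.exp (2 * dotR t (rePart z))) *
        (∫⁻ x in K, ENNReal.ofReal (Real.exp (2 * dotR t x)) * EReal.exp (-φ x))⁻¹ := by
  set k := ENNReal.ofReal (2 * Real.pi) ^ n with hk
  have hk0 : k ≠ 0 := ofReal_two_pi_ne_zero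
  have hkt : k ≠ ∞ := ofReal_two_pi_ne_top
  have hΩ : IsOpen (finiteInterior φ) := isOpen_interior
  have hconv : Convex ℝ (finiteInterior φ) := (hφ.convex_lt ⊤).interior
  set L : (Fin n → ℝ) → ℝ≥0∞ := fun t =>
    ∫⁻ x in K, ENNReal.ofReal (Real.exp (2 * dotR t x)) * EReal.exp (-φ x) with hL
  set I := ∫⁻ t, ENNReal.ofReal (Real.exp (2 * dotR t (rePart z))) * (L t)⁻¹ with hI
  have hLm : AEMeasurable L := aemeasurable_laplace hφ.aemeasurable_exp_neg.restrict
  obtain ⟨M, hM⟩ := hK.exists_bound_of_continuousOn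
    (f := fun x => ∑ i, (x i - rePart z i) ^ 2) (by fun_prop)
  have main : ∀ ε : ℝ, 0 < ε →
      ‖f z‖ₑ ^ 2 ≤ ENNReal.ofReal (Real.exp (2 * (ε * M))) * (k⁻¹ * bergmanNormSq φ f * I) := by
    intro ε hε
    set F : (Fin n → ℂ) → ℂ := fun w => f w * Complex.exp (ε * sqSum z w) with hF
    have hFd : DifferentiableOn ℂ F (tube (finiteInterior φ)) := by
      refine hf.1.mul (DifferentiableOn.cexp ?_)
      unfold sqSum
      fun_prop
    obtain ⟨g, hgm, h1, h2, hFg⟩ := exists_eq_laplace (half_pos hε) hΩ hconv ⟨_, hKΩ hz⟩ hFd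
      (hasGaussianDecay_mul_exp_sqSum hε
        (fun K hK hKc => exists_norm_le_of_mem_bergmanSpace hφ hf hKc hK) z)
    have hP := lintegral_tube_laplace hK.measurableSet (ρ := fun x => EReal.exp (-φ x))
      hφ.aemeasurable_exp_neg.restrict hgm (hFd.continuousOn.mono fun w hw => hKΩ hw)
      (fun x hx => h1 x (hKΩ hx)) (fun x hx => h2 x (hKΩ hx)) (fun w hw => hFg w (hKΩ hw))
    have hle : ∫⁻ w in tube K, ‖F w‖ₑ ^ 2 * EReal.exp (-φ (rePart w)) ≤
        ENNReal.ofReal (Real.exp (2 * (ε * M))) * bergmanNormSq φ f := by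
      rw [bergmanNormSq, ← lintegral_const_mul' _ _ ENNReal.ofReal_ne_top]
      refine (setLIntegral_mono' (measurableSet_tube hK.measurableSet) fun w hw => ?_).trans
        (lintegral_mono_set fun w hw => hKΩ hw)
      rw [← mul_assoc]
      gcongr
      rw [hF, enorm_mul, mul_pow, mul_comm]
      gcongr
      rw [← ofReal_norm, ← ENNReal.ofReal_pow (norm_nonneg _), Complex.norm_exp, ← Real.exp_nat_mul]
      refine ENNReal.ofReal_le_ofReal (Real.exp_le_exp.2 ?_)
      rw [Complex.re_ofReal_mul, re_sqSum]
      have h1 := (Real.le_norm_self _).trans (hM _ hw)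
      have h2 : 0 ≤ ∑ i, (imPart w i - imPart z i) ^ 2 := Finset.sum_nonneg fun i _ => sq_nonneg _
      push_cast
      nlinarith
    rw [hP] at hle
    have hW : ∫⁻ t, ‖g t‖ₑ ^ 2 * L t ≤
        k⁻¹ * (ENNReal.ofReal (Real.exp (2 * (ε * M))) * bergmanNormSq φ f) := by
      rw [← ENNReal.div_eq_inv_mul, ENNReal.le_div_iff_mul_le (.inl hk0) (.inl hkt), mul_comm]
      exact hle
    have hCS := enorm_integral_sq_le hLm
      (.of_forall (laplace_ne_zero hφ hK.measurableSet hKΩ hK0)) hgm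
      (hW.trans_lt (ENNReal.mul_lt_top (by simpa using hk0.bot_lt)
        (ENNReal.mul_lt_top ENNReal.ofReal_lt_top hf.2))) z
    rw [← hFg z (hKΩ hz)] at hCS
    have hFz : F z = f z := by simp [hF, sqSum]
    rw [hFz] at hCS
    refine hCS.trans ((mul_le_mul_left hW I).trans_eq ?_)
    ring
  -- `I` may still be infinite here; the limit survives because the first factor tends to `1 ≠ 0`.
  have hlim : Filter.Tendsto (fun ε : ℝ => ENNReal.ofReal (Real.exp (2 * (ε * M))) *
      (k⁻¹ * bergmanNormSq φ f * I)) (nhdsWithin 0 (Set.Ioi 0))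
      (nhds (1 * (k⁻¹ * bergmanNormSq φ f * I))) := by
    refine ENNReal.Tendsto.mul_const ?_ (.inl one_ne_zero)
    have : Continuous fun ε : ℝ => ENNReal.ofReal (Real.exp (2 * (ε * M))) :=
      ENNReal.continuous_ofReal.comp (by fun_prop)
    simpa using (this.tendsto 0).mono_left nhdsWithin_le_nhds
  rw [one_mul] at hlim
  exact ge_of_tendsto hlim (Filter.eventually_of_mem self_mem_nhdsWithin main)

/-- The Laplace transform of the weight only sees the interior of the domain of `φ`. -/
lemma IsConvexFun.exp_logLaplace_eq {φ : (Fin n → ℝ) → EReal} (hφ : IsConvexFun φ)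
    (t : Fin n → ℝ) : EReal.exp (logLaplace φ t) =
      ∫⁻ x in finiteInterior φ, ENNReal.ofReal (Real.exp (2 * dotR t x)) * EReal.exp (-φ x) := by
  rw [exp_logLaplace, ← lintegral_indicator (measurableSet_finiteInterior φ)]
  refine lintegral_congr_ae ?_
  have hfr := measure_eq_zero_iff_ae_notMem.1 ((hφ.convex_lt ⊤).addHaar_frontier volume)
  filter_upwards [hfr] with x hx
  by_cases hxi : x ∈ finiteInterior φ
  · rw [Set.indicator_of_mem hxi]
  · rw [Set.indicator_of_notMem hxi]
    have : φ x = ⊤ := by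
      by_contra h
      exact hx ⟨subset_closure (lt_top_iff_ne_top.2 h), hxi⟩
    simp [this]

/-- The Laplace transform over `K` is at least a constant times `e^{2t·x₀ + (δ/2) ∑ |tᵢ|}`, so the
integrand decays exponentially. It serves as the dominating function when `K` grows. -/
lemma lintegral_inv_laplace_ne_top {φ : (Fin n → ℝ) → EReal} (hφ : IsConvexFun φ)
    {x₀ : Fin n → ℝ} {δ : ℝ} (hδ : 0 < δ)
    (hball : Metric.closedBall x₀ δ ⊆ finiteInterior φ) {K : Set (Fin n → ℝ)}
    (hK : Metric.closedBall x₀ δ ⊆ K) :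
    ∫⁻ t, ENNReal.ofReal (Real.exp (2 * dotR t x₀)) *
      (∫⁻ x in K, ENNReal.ofReal (Real.exp (2 * dotR t x)) * EReal.exp (-φ x))⁻¹ ≠ ∞ := by
  obtain ⟨c, hc0, hct, hc⟩ := hφ.exists_lt_exp_neg (isCompact_closedBall x₀ δ) hball
  set V := volume (Metric.closedBall (0 : Fin n → ℝ) (δ / 4)) with hV
  have hV0 : V ≠ 0 := (Metric.measure_closedBall_pos volume _ (by positivity)).ne'
  have hVt : V ≠ ∞ := measure_closedBall_lt_top.ne
  have hlow : ∀ t : Fin n → ℝ,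
      ENNReal.ofReal (Real.exp (2 * dotR t x₀ + δ / 2 * ∑ i, |t i|)) * (c * V) ≤
      ∫⁻ x in K, ENNReal.ofReal (Real.exp (2 * dotR t x)) * EReal.exp (-φ x) := by
    intro t
    -- The centre contributes `δ ∑ |tᵢ|` to `2 t · x`, and the radius loses at most half of that.
    set B := Metric.closedBall (x₀ + signVec (δ / 2) t) (δ / 4) with hB
    have hBs : B ⊆ Metric.closedBall x₀ δ := by
      refine Metric.closedBall_subset_closedBall' ?_
      rw [dist_self_add_left]
      linarith [norm_signVec_le (half_pos hδ).le t]
    have hBV : volume B = V := Measure.addHaar_closedBall_center _ _ _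
    calc _ = ∫⁻ _ in B, ENNReal.ofReal (Real.exp (2 * dotR t x₀ + δ / 2 * ∑ i, |t i|)) * c := by
          rw [setLIntegral_const, hBV, mul_assoc]
      _ ≤ ∫⁻ x in B, ENNReal.ofReal (Real.exp (2 * dotR t x)) * EReal.exp (-φ x) := by
          refine setLIntegral_mono' Metric.isClosed_closedBall.measurableSet fun x hx => ?_
          refine mul_le_mul' (ENNReal.ofReal_le_ofReal (Real.exp_le_exp.2 ?_)) (hc x (hBs hx))
          set v := x - (x₀ + signVec (δ / 2) t) with hv
          have hvn : ‖v‖ ≤ δ / 4 := mem_closedBall_iff_norm.1 hx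
          have hxv : x = x₀ + signVec (δ / 2) t + v := by rw [hv]; abel
          rw [hxv, dotR_add, dotR_add, dotR_signVec]
          have h1 := (abs_le.1 (abs_dotR_le t v)).1
          have h2 : 0 ≤ ∑ i, |t i| := Finset.sum_nonneg fun i _ => abs_nonneg _
          nlinarith [mul_le_mul_of_nonneg_right hvn h2]
      _ ≤ _ := lintegral_mono_set (hBs.trans hK)
  have hub : ∀ t : Fin n → ℝ, ENNReal.ofReal (Real.exp (2 * dotR t x₀)) *
      (∫⁻ x in K, ENNReal.ofReal (Real.exp (2 * dotR t x)) * EReal.exp (-φ x))⁻¹ ≤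
      ENNReal.ofReal (Real.exp (-(δ / 2) * ∑ i, |t i|)) * (c * V)⁻¹ := by
    intro t
    refine (mul_le_mul_right (ENNReal.inv_le_inv.2 (hlow t)) _).trans_eq ?_
    rw [ENNReal.mul_inv (.inl (by simpa using Real.exp_pos _)) (.inl ENNReal.ofReal_ne_top),
      ← mul_assoc, ← ENNReal.ofReal_inv_of_pos (Real.exp_pos _),
      ← ENNReal.ofReal_mul (Real.exp_nonneg _), ← Real.exp_neg, ← Real.exp_add]
    congr 3
    ring_nf
  refine ne_top_of_le_ne_top ?_ (lintegral_mono hub)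
  have hcV : (c * V)⁻¹ ≠ ∞ := ENNReal.inv_ne_top.2 (mul_ne_zero hc0 hV0)
  rw [lintegral_mul_const' _ _ hcV]
  refine ENNReal.mul_ne_top ?_ hcV
  exact (integrable_exp_neg_mul_sum_abs (half_pos hδ)).lintegral_lt_top.ne

/-- The upper bound for the Bergman kernel. -/
lemma bergmanKernel_bergmanSpace_le {φ : (Fin n → ℝ) → EReal} (hφ : IsConvexFun φ)
    {z : Fin n → ℂ} (hz : rePart z ∈ finiteInterior φ) :
    bergmanKernel (bergmanSpace φ) (bergmanNormSq φ) z ≤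
      (ENNReal.ofReal (2 * Real.pi) ^ n)⁻¹ * ∫⁻ t, EReal.exp
        (((2 * dotR t (rePart z) : ℝ) : EReal) - logLaplace φ t) := by
  refine iSup₂_le fun f hf => ENNReal.div_le_of_le_mul ?_
  simp only [exp_coe_sub, hφ.exp_logLaplace_eq]
  have hΩ : IsOpen (finiteInterior φ) := isOpen_interior
  obtain ⟨δ, hδ, hδΩ⟩ := Metric.nhds_basis_closedBall.mem_iff.1 (hΩ.mem_nhds hz)
  obtain ⟨C, hCc, hCΩ, hCu, hCm⟩ := hΩ.exists_iUnion_isClosed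
  set B := Metric.closedBall (rePart z) δ with hB
  -- Adjoining the ball `B` to every set of the exhaustion keeps `rePart z` in it, makes its volume
  -- positive, and gives a finite integral already at `K 0`.
  set K : ℕ → Set (Fin n → ℝ) := fun m => Metric.closedBall 0 m ∩ C m ∪ B with hKdef
  have hKc : ∀ m, IsCompact (K m) := fun m =>
    ((isCompact_closedBall _ _).inter_right (hCc m)).union (isCompact_closedBall _ _)
  have hKΩ : ∀ m, K m ⊆ finiteInterior φ := fun m =>
    Set.union_subset (Set.inter_subset_right.trans (hCΩ m)) hδΩ
  have hBK : ∀ m, B ⊆ K m := fun m => Set.subset_union_right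
  have hKmono : Monotone K := fun a b hab => Set.union_subset_union_left _
    (Set.inter_subset_inter (Metric.closedBall_subset_closedBall (by exact_mod_cast hab)) (hCm hab))
  have hKu : ⋃ m, K m = finiteInterior φ := by
    refine Set.Subset.antisymm (Set.iUnion_subset hKΩ) fun x hx => ?_
    rw [← hCu, Set.mem_iUnion] at hx
    obtain ⟨a, ha⟩ := hx
    obtain ⟨b, hb⟩ := exists_nat_ge ‖x‖
    refine Set.mem_iUnion.2 ⟨max a b, Or.inl ⟨?_, hCm (le_max_left a b) ha⟩⟩
    rw [mem_closedBall_zero_iff]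
    exact hb.trans (by exact_mod_cast le_max_right a b)
  have hB0 : volume B ≠ 0 := (Metric.measure_closedBall_pos volume _ hδ).ne'
  have hlim : Filter.Tendsto (fun m => ∫⁻ t, ENNReal.ofReal (Real.exp (2 * dotR t (rePart z))) *
      (∫⁻ x in K m, ENNReal.ofReal (Real.exp (2 * dotR t x)) * EReal.exp (-φ x))⁻¹) Filter.atTop
      (nhds (∫⁻ t, ENNReal.ofReal (Real.exp (2 * dotR t (rePart z))) * (∫⁻ x in finiteInterior φ,
        ENNReal.ofReal (Real.exp (2 * dotR t x)) * EReal.exp (-φ x))⁻¹)) := by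
    refine tendsto_lintegral_of_dominated_convergence'
      (fun t => ENNReal.ofReal (Real.exp (2 * dotR t (rePart z))) *
        (∫⁻ x in K 0, ENNReal.ofReal (Real.exp (2 * dotR t x)) * EReal.exp (-φ x))⁻¹)
      (fun m => ?_) (fun m => .of_forall fun t => ?_)
      (lintegral_inv_laplace_ne_top hφ hδ hδΩ (hBK 0)) (.of_forall fun t => ?_)
    · exact (ENNReal.measurable_ofReal.comp
        (Continuous.measurable (by fun_prop))).aemeasurable.mul
          (aemeasurable_laplace hφ.aemeasurable_exp_neg.restrict).inv
    · exact mul_le_mul_right (ENNReal.inv_le_inv.2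
        (lintegral_mono_set (hKmono (Nat.zero_le m)))) _
    · refine ENNReal.Tendsto.const_mul (tendsto_inv_iff.2 ?_) (.inr ENNReal.ofReal_ne_top)
      -- Continuity from below of the measure with density `e^{2t·x - φ(x)}`.
      have := tendsto_measure_iUnion_atTop (μ := volume.withDensity fun x =>
        ENNReal.ofReal (Real.exp (2 * dotR t x)) * EReal.exp (-φ x)) hKmono
      rw [hKu, withDensity_apply _ hΩ.measurableSet] at this
      simpa only [Function.comp_def, withDensity_apply _ (hKc _).measurableSet] using this
  have hconst : (ENNReal.ofReal (2 * Real.pi) ^ n)⁻¹ * bergmanNormSq φ f ≠ ∞ :=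
    ENNReal.mul_ne_top (ENNReal.inv_ne_top.2 ofReal_two_pi_ne_zero) hf.2.ne
  rw [mul_right_comm]
  refine ge_of_tendsto (ENNReal.Tendsto.const_mul hlim (.inr hconst)) (.of_forall fun m => ?_)
  exact enorm_sq_le_of_isCompact hφ hf (hKc m) (hKΩ m)
    (fun h0 => hB0 (measure_mono_null (hBK m) h0)) (hBK m (Metric.mem_closedBall_self hδ.le))

end PaleyWiener

theorem proposition3p2 (n : ℕ) :
    (∀ ψ : (Fin n → ℝ) → EReal, PaleyWiener.IsConvexFun ψ →
      ∀ U : Set (Fin n → ℝ), IsOpen U →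
        ∀ z : Fin n → ℂ, PaleyWiener.rePart z ∈ U →
          PaleyWiener.bergmanKernel (PaleyWiener.PW ψ U) (PaleyWiener.pwNormSq ψ U) z =
            ∫⁻ t : Fin n → ℝ, EReal.exp
              (((2 * PaleyWiener.dotR t (PaleyWiener.rePart z) : ℝ) : EReal) - ψ t)) ∧
    (∀ φ : (Fin n → ℝ) → EReal, PaleyWiener.IsConvexFun φ →
      ∀ z : Fin n → ℂ, PaleyWiener.rePart z ∈ PaleyWiener.finiteInterior φ →
        PaleyWiener.bergmanKernel (PaleyWiener.bergmanSpace φ) (PaleyWiener.bergmanNormSq φ) z =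
          (ENNReal.ofReal (2 * Real.pi) ^ n)⁻¹ *
            ∫⁻ t : Fin n → ℝ, EReal.exp
              (((2 * PaleyWiener.dotR t (PaleyWiener.rePart z) : ℝ) : EReal)
                - PaleyWiener.logLaplace φ t)) := by
  refine ⟨fun ψ hψ U _ z hz => PaleyWiener.bergmanKernel_PW hψ hz, fun φ hφ z hz => ?_⟩
  exact le_antisymm (PaleyWiener.bergmanKernel_bergmanSpace_le hφ hz)
    (PaleyWiener.le_bergmanKernel_bergmanSpace hφ hz)
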